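/- Let $K$ be a field, $n\ge 1$, $S=K[x_1,\dots,x_n]$ and $\mathfrak m=(x_1,\dots,x_n)$. For a monomial ideal $I\subset S$ let $G(I)$ be its minimal monomial generating set, let $\operatorname{supp}(I)=\{i : x_i \text{ divides some } u\in G(I)\}$, and let $\operatorname{pd}(I)$ be the projective dimension of $I$ as an $S$-module. If $I$ is generated in degree $d$, write $\operatorname{soc}(I)$ for the monomial ideal generated by the elements of degree $d-1$ of $G(I:\mathfrak m)$. (1) Let $I\subset S$ be a monomial ideal with a $d$-linear resolution (that is, with a graded free resolution $\cdots\to S(-d-1)^{b_1}\to S(-d)^{b_0}\to I\to 0$) and with $\operatorname{supp}(I)=\{1,\dots,n\}$. Then $\operatorname{soc}(I)$ is the unique monomial ideal $J$ generated in degree $d-1$ with $I:\mathfrak m=J+I$, and $$\operatorname{pd}(I)=n-1\iff \operatorname{soc}(I)\neq (0).$$ (2) Let $I\subset S$ be a monomial ideal all of whose minimal monomial generators have the same degree $d$, with $\operatorname{supp}(I)=\{1,\dots,n\}$. Let $\succ$ be a monomial order on $S$ with $x_1\succ x_2\succ\dots\succ x_n$, and suppose that $I$ has linear quotients with respect to $\succ$: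 if $G(I)=\{u_1\succ u_2\succ\dots\succ u_m\}$, then for every $k=2,\dots,m$ the ideal $(u_1,\dots,u_{k-1}):u_k$ is generated by a subset of $\{x_1,\dots,x_n\}$. Then $\operatorname{soc}(I)$ is the unique monomial ideal $J$ generated in degree $d-1$ with $I:\mathfrak m=J+I$, and the following conditions are equivalent: (i) $\operatorname{pd}(I)=n-1$; (ii) $\operatorname{soc}(I)\ne(0)$; (iii) there exists $u\in G(I)$, divisible by $x_n$, such that $x_i(u/x_n)\in G(I)$ for all $i=1,\dots,n$. Furthermore, $$G(\operatorname{soc}(I))=\{u/x_n : u\in G(I),\ x_n\mid u,\ x_i(u/x_n)\in G(I)\text{ for all } i=1,\dots,n\}.$$ -/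

import Mathlib

universe u

noncomputable section

namespace MonIdeal

open MvPolynomial

variable {K : Type u} [Field K] {n : ℕ}

/-- The ideal of `K[x_1, …, x_n]` generated by the monomials with exponent vectors in `A`. -/
def monomialSpan (K : Type u) [Field K] {n : ℕ} (A : Set (Fin n →₀ ℕ)) :
    Ideal (MvPolynomial (Fin n) K) :=
  Ideal.span ((fun a => monomial a (1 : K)) '' A)

/-- `I` is a monomial ideal: it is generated by a set of monomials. -/
def IsMonomialIdeal (I : Ideal (MvPolynomial (Fin n) K)) : Prop :=
  ∃ A : Set (Fin n →₀ ℕ), I = monomialSpan K A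

/-- `G(I)`: the (exponent vectors of the) monomials in `I` that are minimal with respect to
divisibility. For a monomial ideal this is its unique minimal monomial generating set. -/
def minGens (I : Ideal (MvPolynomial (Fin n) K)) : Set (Fin n →₀ ℕ) :=
  {a | Minimal (fun b : Fin n →₀ ℕ => monomial b (1 : K) ∈ I) a}

/-- `supp(I)`: the set of the indices `i` such that `x_i` divides some element of `G(I)`. -/
def supp (I : Ideal (MvPolynomial (Fin n) K)) : Set (Fin n) :=
  {i | ∃ a ∈ minGens I, a i ≠ 0}

/-- All elements of `G(I)` have degree `d`. -/
def Equigenerated (I : Ideal (MvPolynomial (Fin n) K)) (d : ℕ) : Prop :=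
  ∀ a ∈ minGens I, a.degree = d

/-- The graded maximal ideal `𝔪 = (x_1, …, x_n)`. -/
def irrelevant (K : Type u) [Field K] (n : ℕ) : Ideal (MvPolynomial (Fin n) K) :=
  Ideal.span (Set.range X)

/-- `I` has a `d`-linear resolution, i.e. a graded free resolution
`⋯ → S(-d-2)^{b_2} → S(-d-1)^{b_1} → S(-d)^{b_0} → I → 0`. In bases, the augmentation is given by
homogeneous generators `g_j` of `I` of degree `d`, and the `i`-th differential
`S(-d-i-1)^{b_{i+1}} → S(-d-i)^{b_i}` by a matrix of linear forms. Such a resolution is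
automatically minimal. -/
def HasLinearResolution (I : Ideal (MvPolynomial (Fin n) K)) (d : ℕ) : Prop :=
  ∃ (b : ℕ → ℕ) (g : Fin (b 0) → MvPolynomial (Fin n) K)
    (A : (i : ℕ) → Matrix (Fin (b i)) (Fin (b (i + 1))) (MvPolynomial (Fin n) K)),
    (∀ j, (g j).IsHomogeneous d) ∧
    (∀ i p q, (A i p q).IsHomogeneous 1) ∧
    Ideal.span (Set.range g) = I ∧
    Function.Exact (A 0).mulVecLin (Fintype.linearCombination (MvPolynomial (Fin n) K) g) ∧
    ∀ i, Function.Exact (A (i + 1)).mulVecLin (A i).mulVecLin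

/-- The monomial order `m` is induced by `x_1 > x_2 > ⋯ > x_n`. -/
def InducedByVars (m : MonomialOrder (Fin n)) : Prop :=
  ∀ i j : Fin n, i < j → m.toSyn (Finsupp.single j 1) < m.toSyn (Finsupp.single i 1)

/-- `I` has linear quotients with respect to the monomial order `m`: listing `G(I)` decreasingly,
`u_1 ≻ u_2 ≻ ⋯ ≻ u_r`, each colon ideal `(u_1, …, u_{k-1}) : u_k` is generated by a subset of the
variables. (For `k = 1` this holds automatically, with the empty subset.) -/
def HasLinearQuotients (I : Ideal (MvPolynomial (Fin n) K)) (m : MonomialOrder (Fin n)) : Prop :=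
  ∀ a ∈ minGens I, ∃ s : Set (Fin n),
    (monomialSpan K {b | b ∈ minGens I ∧ m.toSyn a < m.toSyn b}).colon {monomial a (1 : K)} =
      Ideal.span (X '' s)

/-- `J` is a monomial ideal generated in degree `d - 1` with `I : 𝔪 = J + I`. -/
def IsSocleIdeal (I : Ideal (MvPolynomial (Fin n) K)) (d : ℕ)
    (J : Ideal (MvPolynomial (Fin n) K)) : Prop :=
  IsMonomialIdeal J ∧ (∀ w ∈ minGens J, w.degree + 1 = d) ∧ I.colon (irrelevant K n) = J ⊔ I

/-- The socle ideal `soc(I)` of an ideal `I` generated in degree `d`: the monomial ideal generated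
by `G(I : 𝔪)_{d-1}`, the elements of degree `d - 1` of `G(I : 𝔪)`. -/
def soc (I : Ideal (MvPolynomial (Fin n) K)) (d : ℕ) : Ideal (MvPolynomial (Fin n) K) :=
  monomialSpan K {w | w ∈ minGens (I.colon (irrelevant K n)) ∧ w.degree + 1 = d}

/-- The projective dimension of `I` as an `S`-module. -/
def pd (I : Ideal (MvPolynomial (Fin n) K)) : WithBot ℕ∞ :=
  CategoryTheory.projectiveDimension (ModuleCat.of (MvPolynomial (Fin n) K) I)

/-- The index of the last variable `x_n`. -/
def lastVar (hn : 1 ≤ n) : Fin n := ⟨n - 1, by omega⟩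

end MonIdeal

end

/-!
Write `S = K[x_1, …, x_n]` and `𝔪 = (x_1, …, x_n)`. Two questions about an equigenerated monomial
ideal `I` have to be settled: in which degree the socle `(I : 𝔪) / I` of `S / I` lives, and when
`pd I` reaches its largest possible value `n - 1`. If the monomials of `(I : 𝔪) \ I` all have degree
`d - 1`, then `I : 𝔪 = soc(I) + I`, uniqueness of the socle ideal is a comparison of minimal
generators, and `soc(I) ≠ 0` means that `I` is not saturated (`isSocleIdeal_iff`, `soc_ne_bot_iff`).

The socle of `S / I` is its top Koszul homology `H_n(x; S / I)`. Koszul homology vanishes on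
projective modules in positive degrees, so it moves by one degree along each short exact sequence
`0 → N → P → M → 0` with `P` projective; hence a module of projective dimension at most `k` has no
Koszul homology above degree `k`, and an ideal with `pd I ≤ n - 2` is saturated
(`colon_le_of_hasProjectiveDimensionLT`). This gives the lower bound for `pd I` in both parts.

*Linear resolutions.* Move along the syzygies `N` of the resolution. As they are generated by
vectors of linear forms, a vector of `N` with all entries in `𝔪²` lies in `𝔪 N`. Chasing a Koszul
cycle of `S / I` whose coefficients have degree at least `d` down the resolution, one stays inside
`𝔪 N`, and at the end everything in `𝔪 N` is a boundary; so the socle has nothing in degree `≥ d`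
(`HasLinearResolution.koszulVanishes_quotient`). In the other direction, if `H_{k+1}(x; S / I) = 0`
then `N / 𝔪 N → F / 𝔪 F` is injective for the `k`-th syzygy module `N ⊆ 𝔪 F` of `I`, so that
`N = 𝔪 N = 0` and the resolution stops (`HasLinearResolution.hasProjectiveDimensionLT`). The case
`k = n` is automatic, the case `k = n - 1` is that of a saturated ideal.

*Linear quotients.* Each monomial of `I` is uniquely `x^c u` with `u ∈ G(I)` and `c` avoiding the
variables of the colon ideal at `u` (`HasLinearQuotients.isLeadGen_add_iff`), and the last variable
is in none of these colon ideals (`lastVar_notMem_colonVars`). Comparing two such decompositions of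
`x_i x_n w` shows that a monomial `w` in `(I : 𝔪) \ I` has degree `d - 1`
(`HasLinearQuotients.socleInDegree`). Adjoining the generators one by one bounds `pd I` by the
largest number of variables in a colon ideal, and if that number is `n - 1` at `u`, then `u / x_n`
is a socle element (`HasLinearQuotients.exists_add_single_lastVar`).
-/

namespace MonIdeal

/-! ### The Koszul complex of a sequence -/

/-- The index set of the Koszul complex on the first `r` elements of a sequence in homological
degree `j`: the `j`-element subsets of `{0, …, r - 1}`, built by deciding for each index in turn
whether it is left out (`skip`) or included (`take`). -/
inductive KoszulIndex : ℕ → ℕ → Type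
  | nil : KoszulIndex 0 0
  | skip {r j : ℕ} : KoszulIndex r j → KoszulIndex (r + 1) j
  | take {r j : ℕ} : KoszulIndex r j → KoszulIndex (r + 1) (j + 1)

namespace KoszulIndex

theorem card_le {r j : ℕ} (t : KoszulIndex r j) : j ≤ r := by
  induction t with
  | nil => exact le_rfl
  | skip _ ih => omega
  | take _ ih => omega

/-- The empty subset of `{0, …, r - 1}`. -/
def bot : ∀ r : ℕ, KoszulIndex r 0
  | 0 => nil
  | r + 1 => skip (bot r)

theorem eq_bot : ∀ {r : ℕ} (t : KoszulIndex r 0), t = bot r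
  | _, nil => rfl
  | _, skip t => by rw [eq_bot t]; rfl

/-- The full subset of `{0, …, r - 1}`. -/
def top : ∀ r : ℕ, KoszulIndex r r
  | 0 => nil
  | r + 1 => take (top r)

theorem eq_top : ∀ {r : ℕ} (t : KoszulIndex r r), t = top r
  | _, nil => rfl
  | _, skip t => absurd t.card_le (by omega)
  | _, take t => by rw [eq_top t]; rfl

end KoszulIndex

section Koszul

open KoszulIndex

variable {R : Type*} [CommRing R] {M N P : Type*} [AddCommGroup M] [Module R M]
  [AddCommGroup N] [Module R N] [AddCommGroup P] [Module R P]

/-- The differential of the Koszul complex of the module `M` on the first `r` elements of the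
sequence `x`. The complex on `r + 1` elements is the mapping cone of multiplication by `x r` on the
complex on `r` elements, whence the recursion. -/
def koszulD (x : ℕ → R) : ∀ {r j : ℕ}, (KoszulIndex r (j + 1) → M) → KoszulIndex r j → M
  | _, _, _, nil => 0
  | r + 1, _, f, skip t => koszulD x (fun s => f (skip s)) t + x r • f (take t)
  | _, _, f, take t => - koszulD x (fun s => f (take s)) t

section
variable (x : ℕ → R)

theorem koszulD_add {r j : ℕ} (t : KoszulIndex r j) (f g : KoszulIndex r (j + 1) → M) :
    koszulD x (fun s => f s + g s) t = koszulD x f t + koszulD x g t := by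
  induction t with
  | nil => simp [koszulD]
  | skip t ih => simp only [koszulD, ih, smul_add]; abel
  | take t ih => simp only [koszulD, ih]; abel

theorem koszulD_smul {r j : ℕ} (t : KoszulIndex r j) (c : R) (f : KoszulIndex r (j + 1) → M) :
    koszulD x (fun s => c • f s) t = c • koszulD x f t := by
  induction t with
  | nil => simp [koszulD]
  | skip t ih => simp only [koszulD, ih, smul_add, smul_comm c (x _)]
  | take t ih => simp only [koszulD, ih, smul_neg]

theorem koszulD_neg {r j : ℕ} (t : KoszulIndex r j) (f : KoszulIndex r (j + 1) → M) :
    koszulD x (fun s => - f s) t = - koszulD x f t := by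
  simpa using koszulD_smul x t (-1) f

theorem koszulD_sub {r j : ℕ} (t : KoszulIndex r j) (f g : KoszulIndex r (j + 1) → M) :
    koszulD x (fun s => f s - g s) t = koszulD x f t - koszulD x g t := by
  simp only [sub_eq_add_neg, koszulD_add x t f (fun s => - g s), koszulD_neg]

theorem koszulD_eq_zero_of_le {r j : ℕ} (h : r ≤ j) (t : KoszulIndex r j)
    (f : KoszulIndex r (j + 1) → M) : koszulD x f t = 0 := by
  rw [show f = fun s => (0 : R) • f s from funext fun s => absurd s.card_le (by omega),
    koszulD_smul, zero_smul]

theorem koszulD_map {r j : ℕ} (t : KoszulIndex r j) (φ : M →ₗ[R] N)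
    (f : KoszulIndex r (j + 1) → M) :
    koszulD x (fun s => φ (f s)) t = φ (koszulD x f t) := by
  induction t with
  | nil => simp [koszulD]
  | skip t ih => simp only [koszulD, ih, map_add, map_smul]
  | take t ih => simp only [koszulD, ih, map_neg]

theorem koszulD_koszulD {r j : ℕ} (t : KoszulIndex r j) (f : KoszulIndex r (j + 2) → M) :
    koszulD x (koszulD x f) t = 0 := by
  induction t with
  | nil => simp [koszulD]
  | skip t ih => simp only [koszulD, koszulD_add, koszulD_smul, ih]; simp
  | take t ih => simp only [koszulD, koszulD_neg, ih]; simp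

/-- The ideal generated by the first `r` elements of a sequence. -/
def initialIdeal (r : ℕ) : Ideal R := Ideal.span (x '' Set.Iio r)

variable {x}

theorem mem_initialIdeal {i r : ℕ} (h : i < r) : x i ∈ initialIdeal x r :=
  Ideal.subset_span ⟨i, h, rfl⟩

theorem initialIdeal_succ (r : ℕ) :
    initialIdeal x (r + 1) = initialIdeal x r ⊔ Ideal.span {x r} := by
  rw [initialIdeal, initialIdeal, ← Ideal.span_union, ← Set.image_singleton, ← Set.image_union]
  congr 2
  ext i
  simp only [Set.mem_Iio, Set.mem_union, Set.mem_singleton_iff]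
  omega

theorem koszulD_mem {r j : ℕ} (t : KoszulIndex r j) {Q : Submodule R M}
    {f : KoszulIndex r (j + 1) → M} (hf : ∀ s, f s ∈ Q) :
    koszulD x f t ∈ initialIdeal x r • Q := by
  induction t with
  | nil => simp [koszulD]
  | @skip r j t ih =>
    refine add_mem ?_ (Submodule.smul_mem_smul (mem_initialIdeal (Nat.lt_succ_self r)) (hf _))
    refine Submodule.smul_mono_left ?_ (ih fun s => hf _)
    rw [initialIdeal_succ]
    exact le_sup_left
  | @take r j t ih =>
    refine neg_mem (Submodule.smul_mono_left ?_ (ih fun s => hf _))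
    rw [initialIdeal_succ]
    exact le_sup_left

/-- The boundaries in degree zero fill out `(x 0, …, x (r - 1)) M`. -/
theorem exists_koszulD_eq {r : ℕ} {m : M} (hm : m ∈ initialIdeal x r • (⊤ : Submodule R M)) :
    ∃ f : KoszulIndex r 1 → M, koszulD x f = fun _ => m := by
  induction r generalizing m with
  | zero =>
    have : m = 0 := by simpa [initialIdeal] using hm
    exact ⟨0, by funext t; cases t; simp [koszulD, this]⟩
  | succ r ih =>
    rw [initialIdeal_succ, Submodule.sup_smul, Submodule.mem_sup] at hm
    obtain ⟨a, ha, b, hb, rfl⟩ := hm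
    obtain ⟨f, hf⟩ := ih ha
    rw [Submodule.ideal_span_singleton_smul] at hb
    obtain ⟨c, -, rfl⟩ := hb
    refine ⟨fun | skip t => f t | take _ => c, ?_⟩
    funext t
    cases t with
    | skip t => simpa [koszulD] using congrFun hf t

/-- A chain in top degree is a cycle exactly when its coefficient is annihilated by the sequence. -/
theorem koszulD_top_eq_zero_iff {r : ℕ} {f : KoszulIndex (r + 1) (r + 1) → M} :
    koszulD x f = 0 ↔ ∀ i < r + 1, x i • f (top (r + 1)) = 0 := by
  have key : ∀ {r : ℕ} (f : KoszulIndex (r + 1) (r + 1) → M) (s : KoszulIndex r r),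
      koszulD x f (skip s) = x r • f (top (r + 1)) := by
    intro r f s
    simp [koszulD, koszulD_eq_zero_of_le x le_rfl, eq_top (take s)]
  induction r with
  | zero =>
    refine ⟨fun h i hi => ?_, fun h => ?_⟩
    · obtain rfl : i = 0 := by omega
      rw [← key f nil, h]; rfl
    · funext t
      cases t with
      | skip s => rw [key]; exact h 0 (by omega)
  | succ r ih =>
    have ih' := ih (f := fun s => f (take s))
    refine ⟨fun h i hi => ?_, fun h => ?_⟩
    · rcases Nat.lt_succ_iff_lt_or_eq.1 hi with hi | rfl
      · refine ih'.1 ?_ i hi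
        funext t
        have := congrFun h (take t)
        simpa [koszulD] using this
      · rw [← key f (top _), h]; rfl
    · funext t
      cases t with
      | skip s => rw [key]; exact h _ (by omega)
      | take s =>
        have := congrFun (ih'.2 fun i hi => h i (by omega)) s
        simp [koszulD, this]

end

/-- Relative vanishing of Koszul homology in degree `j + 1`: each cycle with coefficients in the
submodule `Q` is a boundary in `M`. For `Q = ⊤` this says `H_{j+1}(x; M) = 0`. -/
def KoszulVanishes (x : ℕ → R) (r j : ℕ) (Q : Submodule R M) : Prop :=
  ∀ f : KoszulIndex r (j + 1) → M, (∀ t, f t ∈ Q) → koszulD x f = 0 →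
    ∃ g : KoszulIndex r (j + 2) → M, koszulD x g = f

section
variable {x : ℕ → R}

theorem koszulVanishes_of_le {r j : ℕ} (h : r ≤ j) (Q : Submodule R M) :
    KoszulVanishes x r j Q := fun f _ _ =>
  ⟨0, funext fun t => absurd t.card_le (by omega)⟩

/-- The Koszul complex of a (weakly) regular sequence is acyclic in positive degrees. -/
theorem koszulVanishes_of_regular {r : ℕ}
    (hx : ∀ i < r, ∀ m : M, x i • m ∈ initialIdeal x i • (⊤ : Submodule R M) →
      m ∈ initialIdeal x i • (⊤ : Submodule R M)) (j : ℕ) :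
    KoszulVanishes x r j (⊤ : Submodule R M) := by
  induction r generalizing j with
  | zero => exact koszulVanishes_of_le (Nat.zero_le _) _
  | succ r ih =>
    have ih' := ih fun i hi => hx i (by omega)
    intro f _ hf
    -- The `take` part `b` of the cycle is a boundary: for `j = 0` by regularity of `x r`.
    have hb : ∃ b : KoszulIndex r (j + 1) → M, koszulD x b = fun s => f (take s) := by
      cases j with
      | zero =>
        have h1 : x r • f (take (bot r)) ∈ initialIdeal x r • (⊤ : Submodule R M) := by
          have h2 : koszulD x (fun s => f (skip s)) (bot r) + x r • f (take (bot r)) = 0 :=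
            congrFun hf (skip (bot r))
          rw [eq_neg_of_add_eq_zero_right h2]
          exact neg_mem (koszulD_mem _ fun _ => Submodule.mem_top)
        obtain ⟨b, hb⟩ := exists_koszulD_eq (hx r (by omega) _ h1)
        exact ⟨b, by rw [hb]; funext s; rw [eq_bot s]⟩
      | succ j =>
        refine ih' j _ (fun _ => Submodule.mem_top) ?_
        funext t
        have := congrFun hf (take t)
        simpa [koszulD] using this
    obtain ⟨b, hb⟩ := hb
    obtain ⟨a, ha⟩ := ih' j (fun s => f (skip s) + x r • b s) (fun _ => Submodule.mem_top) (by
      funext t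
      have := congrFun hf (skip t)
      simp only [koszulD] at this
      rw [koszulD_add, koszulD_smul, hb]
      exact this)
    refine ⟨fun | skip t => a t | take t => - b t, ?_⟩
    funext t
    cases t with
    | skip t => simp [koszulD, ha]
    | take t => simp [koszulD, koszulD_neg, hb]

variable {ψ : N →ₗ[R] P} {φ : P →ₗ[R] M} {r j : ℕ}

/-- The connecting homomorphism: a cycle in `M` lifts to `P`, and its boundary comes from a cycle
in `N`. -/
theorem exists_lift_cycle (hex : Function.Exact ψ φ)
    (Q : Submodule R P) {f : KoszulIndex r (j + 1) → M} (hfQ : ∀ t, f t ∈ Q.map φ)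
    (hf : koszulD x f = 0) :
    ∃ (p : KoszulIndex r (j + 1) → P) (z : KoszulIndex r j → N), (∀ t, φ (p t) = f t) ∧
      (∀ t, ψ (z t) = koszulD x p t) ∧ (∀ t, ψ (z t) ∈ initialIdeal x r • Q) := by
  choose p hpQ hp using hfQ
  have h1 : ∀ t, φ (koszulD x p t) = 0 := by
    intro t
    rw [← koszulD_map, show (fun s => φ (p s)) = f from funext hp, hf]; rfl
  choose z hz using fun t => (hex _).1 (h1 t)
  exact ⟨p, z, hp, hz, fun t => hz t ▸ koszulD_mem t hpQ⟩

theorem KoszulVanishes.succ_of_exact (hψ : Function.Injective ψ) (hex : Function.Exact ψ φ)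
    {Q : Submodule R P} {Q' : Submodule R N} (hQ : (initialIdeal x r • Q).comap ψ ≤ Q')
    (hN : KoszulVanishes x r j Q') (hP : KoszulVanishes x r (j + 1) (⊤ : Submodule R P)) :
    KoszulVanishes x r (j + 1) (Q.map φ) := by
  intro f hfQ hf
  obtain ⟨p, z, hp, hz, hzQ⟩ := exists_lift_cycle hex Q hfQ hf
  obtain ⟨y, hy⟩ := hN z (fun t => hQ (hzQ t)) (by
    funext t
    apply hψ
    rw [← koszulD_map, show (fun s => ψ (z s)) = koszulD x p from funext hz, koszulD_koszulD]
    simp)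
  obtain ⟨g, hg⟩ := hP (fun t => p t - ψ (y t)) (fun _ => Submodule.mem_top) (by
    funext t
    rw [koszulD_sub, koszulD_map, hy, hz, sub_self]; rfl)
  refine ⟨fun t => φ (g t), ?_⟩
  funext t
  rw [koszulD_map, hg, map_sub, hp, hex.apply_apply_eq_zero, sub_zero]

theorem KoszulVanishes.zero_of_exact (hex : Function.Exact ψ φ)
    {Q : Submodule R P}
    (hQ : (initialIdeal x r • Q).comap ψ ≤ initialIdeal x r • (⊤ : Submodule R N))
    (hP : KoszulVanishes x r 0 (⊤ : Submodule R P)) :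
    KoszulVanishes x r 0 (Q.map φ) := by
  intro f hfQ hf
  obtain ⟨p, z, hp, hz, hzQ⟩ := exists_lift_cycle hex Q hfQ hf
  obtain ⟨y, hy⟩ := exists_koszulD_eq (hQ (hzQ (bot r)))
  obtain ⟨g, hg⟩ := hP (fun t => p t - ψ (y t)) (fun _ => Submodule.mem_top) (by
    funext t
    rw [koszulD_sub, koszulD_map, hy, ← hz, eq_bot t, sub_self]; rfl)
  refine ⟨fun t => φ (g t), ?_⟩
  funext t
  rw [koszulD_map, hg, map_sub, hp, hex.apply_apply_eq_zero, sub_zero]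

theorem KoszulVanishes.pred_of_exact (hψ : Function.Injective ψ) (hex : Function.Exact ψ φ)
    (hφ : Function.Surjective φ) (hM : KoszulVanishes x r (j + 1) (⊤ : Submodule R M))
    (hP : KoszulVanishes x r j (⊤ : Submodule R P)) :
    KoszulVanishes x r j (⊤ : Submodule R N) := by
  intro f _ hf
  obtain ⟨y, hy⟩ := hP (fun t => ψ (f t)) (fun _ => Submodule.mem_top) (by
    funext t; rw [koszulD_map, hf]; simp)
  obtain ⟨w, hw⟩ := hM (fun t => φ (y t)) (fun _ => Submodule.mem_top) (by
    funext t; rw [koszulD_map, hy, hex.apply_apply_eq_zero]; rfl)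
  choose w' hw' using fun t => hφ (w t)
  have h1 : ∀ t, φ (y t - koszulD x w' t) = 0 := by
    intro t
    rw [map_sub, ← koszulD_map, show (fun s => φ (w' s)) = w from funext hw', hw, sub_self]
  choose g hg using fun t => (hex _).1 (h1 t)
  refine ⟨g, ?_⟩
  funext t
  apply hψ
  rw [← koszulD_map, show (fun s => ψ (g s)) = fun s => y s - koszulD x w' s from funext hg,
    koszulD_sub, koszulD_koszulD, hy, sub_zero]

/-- If `H_1(x; M) = 0`, then `N / (x) N → P / (x) P` is injective. -/
theorem KoszulVanishes.comap_le_of_exact (hψ : Function.Injective ψ) (hex : Function.Exact ψ φ)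
    (hφ : Function.Surjective φ) (hM : KoszulVanishes x r 0 (⊤ : Submodule R M)) :
    (initialIdeal x r • (⊤ : Submodule R P)).comap ψ ≤ initialIdeal x r • (⊤ : Submodule R N) := by
  intro m hm
  obtain ⟨y, hy⟩ := exists_koszulD_eq (Submodule.mem_comap.1 hm)
  obtain ⟨w, hw⟩ := hM (fun t => φ (y t)) (fun _ => Submodule.mem_top) (by
    funext t; rw [koszulD_map, hy, hex.apply_apply_eq_zero]; rfl)
  choose w' hw' using fun t => hφ (w t)
  have h1 : ∀ t, φ (y t - koszulD x w' t) = 0 := by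
    intro t
    rw [map_sub, ← koszulD_map, show (fun s => φ (w' s)) = w from funext hw', hw, sub_self]
  choose g hg using fun t => (hex _).1 (h1 t)
  have h2 : koszulD x g (bot r) = m := by
    apply hψ
    rw [← koszulD_map, show (fun s => ψ (g s)) = fun s => y s - koszulD x w' s from funext hg,
      koszulD_sub, koszulD_koszulD, hy, sub_zero]
  rw [← h2]
  exact koszulD_mem _ fun _ => Submodule.mem_top

end

end Koszul

open MvPolynomial CategoryTheory

variable {K : Type u} [Field K] {n : ℕ}

/-! ### The Koszul complex of the variables and projective dimension -/

/-- The variables of the polynomial ring as an infinite sequence, continued by zeros. -/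
noncomputable def varSeq (K : Type u) [Field K] (n : ℕ) (i : ℕ) : MvPolynomial (Fin n) K :=
  if h : i < n then X ⟨i, h⟩ else 0

theorem varSeq_of_lt {i : ℕ} (h : i < n) : varSeq K n i = X ⟨i, h⟩ := dif_pos h

theorem initialIdeal_varSeq {r : ℕ} (hr : r ≤ n) :
    initialIdeal (varSeq K n) r = Ideal.span (X '' {i : Fin n | i.1 < r}) := by
  rw [initialIdeal]
  congr 1
  ext p
  constructor
  · rintro ⟨i, hi, rfl⟩
    exact ⟨⟨i, lt_of_lt_of_le hi hr⟩, hi, (varSeq_of_lt _).symm⟩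
  · rintro ⟨i, hi, rfl⟩
    exact ⟨i.1, hi, varSeq_of_lt i.2⟩

theorem initialIdeal_varSeq_self : initialIdeal (varSeq K n) n = irrelevant K n := by
  rw [initialIdeal_varSeq le_rfl, irrelevant, ← Set.image_univ]
  congr 2
  ext i
  simp

theorem support_X_mul_iff {p : MvPolynomial (Fin n) K} {i : Fin n} {a : Fin n →₀ ℕ} :
    a + Finsupp.single i 1 ∈ (X i * p).support ↔ a ∈ p.support := by
  rw [mem_support_iff, mem_support_iff, mul_comm, coeff_mul_X]

theorem mem_span_X_of_X_mul_mem {p : MvPolynomial (Fin n) K} {i : Fin n} {s : Set (Fin n)}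
    (hi : i ∉ s) (h : X i * p ∈ Ideal.span (X '' s : Set (MvPolynomial (Fin n) K))) :
    p ∈ Ideal.span (X '' s : Set (MvPolynomial (Fin n) K)) := by
  rw [mem_ideal_span_X_image] at h ⊢
  intro a ha
  obtain ⟨k, hk, hk'⟩ := h _ (support_X_mul_iff.2 ha)
  refine ⟨k, hk, ?_⟩
  have : i ≠ k := fun h => hi (h ▸ hk)
  simpa [Finsupp.single_apply, this] using hk'

/-- The variables form a regular sequence on each projective module. -/
theorem koszulVanishes_of_projective {P : Type u} [AddCommGroup P]
    [Module (MvPolynomial (Fin n) K) P] [Module.Projective (MvPolynomial (Fin n) K) P] (j : ℕ) :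
    KoszulVanishes (varSeq K n) n j (⊤ : Submodule (MvPolynomial (Fin n) K) P) := by
  refine koszulVanishes_of_regular (fun i hi m hm => ?_) j
  obtain ⟨s, hs⟩ := Module.projective_def.1 ‹Module.Projective (MvPolynomial (Fin n) K) P›
  have key : ∀ p : P, (∀ q, s p q ∈ initialIdeal (varSeq K n) i) →
      p ∈ initialIdeal (varSeq K n) i • (⊤ : Submodule (MvPolynomial (Fin n) K) P) := by
    intro p hp
    rw [← hs p, Finsupp.linearCombination_apply]
    exact Submodule.sum_mem _ fun q _ => Submodule.smul_mem_smul (hp q) Submodule.mem_top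
  have key' : ∀ p ∈ initialIdeal (varSeq K n) i • (⊤ : Submodule (MvPolynomial (Fin n) K) P),
      ∀ q, s p q ∈ initialIdeal (varSeq K n) i := by
    intro p hp q
    refine Submodule.smul_induction_on hp (fun r hr y _ => ?_) fun y z hy hz => ?_
    · rw [map_smul, Finsupp.smul_apply, smul_eq_mul]
      exact Ideal.mul_mem_right _ _ hr
    · rw [map_add, Finsupp.add_apply]
      exact add_mem hy hz
  refine key m fun q => ?_
  have h1 := key' _ hm q
  rw [initialIdeal_varSeq hi.le, varSeq_of_lt hi] at *
  rw [map_smul, Finsupp.smul_apply, smul_eq_mul] at h1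
  exact mem_span_X_of_X_mul_mem (by simp) h1

/-- Modules of projective dimension at most `k` have no Koszul homology in degrees above `k`. -/
theorem koszulVanishes_of_hasProjectiveDimensionLT {k : ℕ} :
    ∀ (M : ModuleCat.{u} (MvPolynomial (Fin n) K)), HasProjectiveDimensionLT M (k + 1) →
      ∀ j, k ≤ j → KoszulVanishes (varSeq K n) n j
        (⊤ : Submodule (MvPolynomial (Fin n) K) M) := by
  induction k with
  | zero =>
    intro M hM j _
    have : Projective M := projective_iff_hasProjectiveDimensionLT_one.2 hM
    have : Module.Projective _ M :=
      (IsProjective.iff_projective (R := MvPolynomial (Fin n) K) M).2 this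
    exact koszulVanishes_of_projective j
  | succ k ih =>
    intro M hM j hj
    obtain ⟨j, rfl⟩ : ∃ l, j = l + 1 := ⟨j - 1, by omega⟩
    have hS := M.shortExact_projectiveShortComplex
    have h1 := (hS.hasProjectiveDimensionLT_X₃_iff k inferInstance).1 hM
    have hP : Module.Projective (MvPolynomial (Fin n) K) M.projectiveShortComplex.X₂ :=
      (IsProjective.iff_projective (R := MvPolynomial (Fin n) K) _).2 inferInstance
    have := KoszulVanishes.succ_of_exact hS.moduleCat_injective_f
      ((ShortComplex.ShortExact.moduleCat_exact_iff_function_exact _).1 hS.exact)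
      (Q := ⊤) (Q' := ⊤) le_top
      (ih _ h1 j (by omega)) (koszulVanishes_of_projective _)
    rwa [Submodule.map_top, LinearMap.range_eq_top.2 hS.moduleCat_surjective_g] at this

theorem hasProjectiveDimensionLT_of_surjective {M P : Type u} [AddCommGroup M] [AddCommGroup P]
    [Module (MvPolynomial (Fin n) K) M] [Module (MvPolynomial (Fin n) K) P]
    [Module.Projective (MvPolynomial (Fin n) K) P] {φ : P →ₗ[MvPolynomial (Fin n) K] M}
    (hφ : Function.Surjective φ) {k : ℕ}
    (h : HasProjectiveDimensionLT (ModuleCat.of (MvPolynomial (Fin n) K) φ.ker) k) :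
    HasProjectiveDimensionLT (ModuleCat.of (MvPolynomial (Fin n) K) M) (k + 1) := by
  have hP : Projective (ModuleCat.of (MvPolynomial (Fin n) K) P) :=
    (IsProjective.iff_projective (R := MvPolynomial (Fin n) K) P).1 inferInstance
  have h1 : HasProjectiveDimensionLT (ModuleCat.of (MvPolynomial (Fin n) K) P) 1 := inferInstance
  exact (LinearMap.shortExact_shortComplexKer hφ).hasProjectiveDimensionLT_X₃ k h
    (hasProjectiveDimensionLT_of_ge _ 1 _ (by omega))

theorem hasProjectiveDimensionLT_zero_of_eq_bot {M : Type u} [AddCommGroup M]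
    [Module (MvPolynomial (Fin n) K) M] {N : Submodule (MvPolynomial (Fin n) K) M} (h : N = ⊥) :
    HasProjectiveDimensionLT (ModuleCat.of (MvPolynomial (Fin n) K) N) 0 := by
  subst h
  exact (ModuleCat.isZero_iff_subsingleton.2 inferInstance).hasProjectiveDimensionLT_zero

theorem eq_bot_of_hasProjectiveDimensionLT_zero {M : Type u} [AddCommGroup M]
    [Module (MvPolynomial (Fin n) K) M] {N : Submodule (MvPolynomial (Fin n) K) M}
    (h : HasProjectiveDimensionLT (ModuleCat.of (MvPolynomial (Fin n) K) N) 0) : N = ⊥ := by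
  have := ModuleCat.isZero_iff_subsingleton.1 (isZero_of_hasProjectiveDimensionLT_zero
    (ModuleCat.of (MvPolynomial (Fin n) K) N))
  exact (Submodule.subsingleton_iff_eq_bot).1 this

theorem mkQ_exact (I : Ideal (MvPolynomial (Fin n) K)) :
    Function.Exact I.subtype I.mkQ := LinearMap.exact_iff.2 (by simp)

theorem mem_colon_irrelevant {I : Ideal (MvPolynomial (Fin n) K)} {p : MvPolynomial (Fin n) K} :
    p ∈ I.colon (irrelevant K n) ↔ ∀ i, X i * p ∈ I := by
  rw [irrelevant, Ideal.colon_span, Submodule.mem_colon]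
  simp [mul_comm]

/-- The top Koszul homology of `S / I` is its socle `(I : 𝔪) / I`. -/
theorem mem_of_koszulVanishes {j : ℕ} (hj : j + 1 = n) {I : Ideal (MvPolynomial (Fin n) K)}
    {Q : Submodule (MvPolynomial (Fin n) K) (MvPolynomial (Fin n) K ⧸ I)}
    (h : KoszulVanishes (varSeq K n) n j Q) {p : MvPolynomial (Fin n) K}
    (hp : p ∈ I.colon (irrelevant K n)) (hpQ : I.mkQ p ∈ Q) : p ∈ I := by
  subst hj
  rw [mem_colon_irrelevant] at hp
  obtain ⟨g, hg⟩ := h (fun _ => I.mkQ p) (fun _ => hpQ) (by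
    refine koszulD_top_eq_zero_iff.2 fun i hi => ?_
    rw [varSeq_of_lt hi, ← map_smul, Submodule.mkQ_apply, Submodule.Quotient.mk_eq_zero]
    exact hp _)
  have h1 : (0 : MvPolynomial (Fin (j + 1)) K ⧸ I) = I.mkQ p := by
    rw [← congrFun hg (KoszulIndex.top _), koszulD_eq_zero_of_le _ le_rfl]
  rwa [eq_comm, Submodule.mkQ_apply, Submodule.Quotient.mk_eq_zero] at h1

theorem koszulVanishes_quotient {j : ℕ} (hj : j + 1 = n) {I : Ideal (MvPolynomial (Fin n) K)}
    (h : I.colon (irrelevant K n) ≤ I) :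
    KoszulVanishes (varSeq K n) n j
      (⊤ : Submodule (MvPolynomial (Fin n) K) (MvPolynomial (Fin n) K ⧸ I)) := by
  subst hj
  intro f _ hf
  have h1 := koszulD_top_eq_zero_iff.1 hf
  refine ⟨0, funext fun t => ?_⟩
  obtain ⟨p, hp⟩ := I.mkQ_surjective (f (KoszulIndex.top _))
  have h2 : p ∈ I := by
    refine h (mem_colon_irrelevant.2 fun i => ?_)
    have := h1 i i.2
    rwa [← hp, varSeq_of_lt i.2, ← map_smul, Submodule.mkQ_apply,
      Submodule.Quotient.mk_eq_zero] at this
  rw [KoszulIndex.eq_top t, koszulD_eq_zero_of_le _ le_rfl, ← hp]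
  exact ((Submodule.Quotient.mk_eq_zero _).2 h2).symm

/-- An ideal of projective dimension at most `n - 2` is saturated: the depth of `S / I` is
positive. -/
theorem colon_le_of_hasProjectiveDimensionLT (hn : 1 ≤ n) {I : Ideal (MvPolynomial (Fin n) K)}
    (hI : I ≠ ⊥)
    (h : HasProjectiveDimensionLT (ModuleCat.of (MvPolynomial (Fin n) K) I) (n - 1)) :
    I.colon (irrelevant K n) ≤ I := by
  rcases Nat.lt_or_ge 1 n with h1 | h1
  · obtain ⟨k, hk⟩ : ∃ k, n = k + 2 := ⟨n - 2, by omega⟩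
    have h2 : KoszulVanishes (varSeq K n) n k (⊤ : Submodule (MvPolynomial (Fin n) K) I) :=
      koszulVanishes_of_hasProjectiveDimensionLT (k := k) _
        (by rwa [show n - 1 = k + 1 by omega] at h) k le_rfl
    have h3 := KoszulVanishes.succ_of_exact (Q := ⊤) (Q' := ⊤) I.subtype_injective
      (mkQ_exact I) le_top h2 (koszulVanishes_of_projective _)
    intro p hp
    refine mem_of_koszulVanishes hk.symm h3 hp ?_
    exact Submodule.mem_map_of_mem Submodule.mem_top
  · obtain rfl : n = 1 := by omega
    exact absurd (eq_bot_of_hasProjectiveDimensionLT_zero h) hI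

theorem pd_eq_iff (hn : 1 ≤ n) {I : Ideal (MvPolynomial (Fin n) K)} :
    pd I = ((n - 1 : ℕ) : WithBot ℕ∞) ↔
      HasProjectiveDimensionLT (ModuleCat.of (MvPolynomial (Fin n) K) I) n ∧
      ¬ HasProjectiveDimensionLT (ModuleCat.of (MvPolynomial (Fin n) K) I) (n - 1) := by
  rw [pd, le_antisymm_iff, projectiveDimension_ge_iff, projectiveDimension_le_iff,
    HasProjectiveDimensionLE, Nat.sub_add_cancel hn]

/-- Once `pd I ≤ n - 1` is known, and `pd I ≤ n - 2` for `I` saturated, the projective dimension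
detects the socle. -/
theorem pd_eq_iff_not_colon_le (hn : 1 ≤ n) {I : Ideal (MvPolynomial (Fin n) K)} (hI : I ≠ ⊥)
    (h1 : HasProjectiveDimensionLT (ModuleCat.of (MvPolynomial (Fin n) K) I) n)
    (h2 : I.colon (irrelevant K n) ≤ I →
      HasProjectiveDimensionLT (ModuleCat.of (MvPolynomial (Fin n) K) I) (n - 1)) :
    pd I = ((n - 1 : ℕ) : WithBot ℕ∞) ↔ ¬ I.colon (irrelevant K n) ≤ I := by
  rw [pd_eq_iff hn, and_iff_right h1, not_iff_not]
  exact ⟨colon_le_of_hasProjectiveDimensionLT hn hI, h2⟩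

section

/-! ### Linear resolutions -/

theorem mem_irrelevant_pow_iff {p : MvPolynomial (Fin n) K} {k : ℕ} :
    p ∈ irrelevant K n ^ k ↔ ∀ a : Fin n →₀ ℕ, a.degree < k → p.coeff a = 0 :=
  mem_pow_idealOfVars_iff' k p

theorem mem_irrelevant_iff {p : MvPolynomial (Fin n) K} :
    p ∈ irrelevant K n ↔ p.coeff 0 = 0 := by
  rw [← pow_one (irrelevant K n), mem_irrelevant_pow_iff]
  simp [Finsupp.degree_eq_zero_iff]

theorem mem_irrelevant_pow_of_isHomogeneous {p : MvPolynomial (Fin n) K} {k : ℕ}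
    (hp : p.IsHomogeneous k) : p ∈ irrelevant K n ^ k :=
  mem_irrelevant_pow_iff.2 fun _ ha => hp.coeff_eq_zero ha.ne

/-- If a combination of forms of degree `e` has order larger than `e`, then the coefficients can be
replaced by their parts in `𝔪`: the constant terms contribute the part of degree `e`. -/
theorem sum_sub_constantCoeff {b e : ℕ} {c g : Fin b → MvPolynomial (Fin n) K}
    (hg : ∀ q, (g q).IsHomogeneous e) (h : ∑ q, c q * g q ∈ irrelevant K n ^ (e + 1)) :
    ∑ q, (c q - C (coeff 0 (c q))) * g q = ∑ q, c q * g q := by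
  have h1 : ∑ q, (c q - C (coeff 0 (c q))) * g q ∈ irrelevant K n ^ (e + 1) := by
    refine sum_mem fun q _ => ?_
    rw [pow_succ']
    exact Ideal.mul_mem_mul (mem_irrelevant_iff.2 (by simp))
      (mem_irrelevant_pow_of_isHomogeneous (hg q))
  have h2 : ∑ q, C (coeff 0 (c q)) * g q ∈ irrelevant K n ^ (e + 1) := by
    have := sub_mem h h1
    rw [← Finset.sum_sub_distrib] at this
    simpa [← sub_mul] using this
  have h3 : (∑ q, C (coeff 0 (c q)) * g q).IsHomogeneous e :=
    IsHomogeneous.sum _ _ _ fun q _ => by simpa using (isHomogeneous_C _ _).mul (hg q)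
  have h4 : ∑ q, C (coeff 0 (c q)) * g q = 0 := by
    ext a
    rw [coeff_zero]
    by_cases ha : a.degree = e
    · exact mem_irrelevant_pow_iff.1 h2 a (by omega)
    · exact h3.coeff_eq_zero ha
  simp only [sub_mul, Finset.sum_sub_distrib, h4, sub_zero]

theorem map_mem_of_mem_smul_top {F : Type*} [AddCommGroup F] [Module (MvPolynomial (Fin n) K) F]
    {J : Ideal (MvPolynomial (Fin n) K)} (l : F →ₗ[MvPolynomial (Fin n) K] MvPolynomial (Fin n) K)
    {v : F} (hv : v ∈ J • (⊤ : Submodule (MvPolynomial (Fin n) K) F)) : l v ∈ J := by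
  refine Submodule.smul_induction_on hv (fun r hr y _ => ?_) fun y z hy hz => ?_
  · rw [map_smul, smul_eq_mul]
    exact Ideal.mul_mem_right _ _ hr
  · rw [map_add]
    exact add_mem hy hz

theorem mem_smul_top_pi {b : ℕ} {J : Ideal (MvPolynomial (Fin n) K)}
    {v : Fin b → MvPolynomial (Fin n) K} (hv : ∀ q, v q ∈ J) :
    v ∈ J • (⊤ : Submodule (MvPolynomial (Fin n) K) (Fin b → MvPolynomial (Fin n) K)) := by
  rw [pi_eq_sum_univ' v]
  exact sum_mem fun q _ => Submodule.smul_mem_smul (hv q) Submodule.mem_top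

theorem map_mem_smul_range {b : ℕ} {F : Type*} [AddCommGroup F]
    [Module (MvPolynomial (Fin n) K) F] {J : Ideal (MvPolynomial (Fin n) K)}
    (φ : (Fin b → MvPolynomial (Fin n) K) →ₗ[MvPolynomial (Fin n) K] F)
    {v : Fin b → MvPolynomial (Fin n) K} (hv : ∀ q, v q ∈ J) : φ v ∈ J • LinearMap.range φ := by
  rw [LinearMap.range_eq_map, ← Submodule.map_smul'']
  exact Submodule.mem_map_of_mem (mem_smul_top_pi hv)

/-- A form of Nakayama's lemma, by Krull's intersection argument. -/
theorem eq_bot_of_le_smul {F : Type*} [AddCommGroup F] [Module (MvPolynomial (Fin n) K) F]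
    (hF : ∀ v : F, (∀ l : F →ₗ[MvPolynomial (Fin n) K] MvPolynomial (Fin n) K, l v = 0) → v = 0)
    {N : Submodule (MvPolynomial (Fin n) K) F} (h : N ≤ irrelevant K n • N) : N = ⊥ := by
  have h1 : ∀ k, N ≤ irrelevant K n ^ k • (⊤ : Submodule (MvPolynomial (Fin n) K) F) := by
    intro k
    induction k with
    | zero => simp
    | succ k ih =>
      refine h.trans ?_
      rw [pow_succ', Submodule.mul_smul]
      exact Submodule.smul_mono le_rfl ih
  refine (Submodule.eq_bot_iff _).2 fun v hv => hF v fun l => ?_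
  ext a
  exact mem_irrelevant_pow_iff.1 (map_mem_of_mem_smul_top l (h1 (a.degree + 1) hv)) a
    (Nat.lt_succ_self _)

theorem eq_bot_of_comap_le {F : Type*} [AddCommGroup F] [Module (MvPolynomial (Fin n) K) F]
    (hF : ∀ v : F, (∀ l : F →ₗ[MvPolynomial (Fin n) K] MvPolynomial (Fin n) K, l v = 0) → v = 0)
    {N : Submodule (MvPolynomial (Fin n) K) F}
    (h : N ≤ irrelevant K n • (⊤ : Submodule (MvPolynomial (Fin n) K) F))
    (h' : (irrelevant K n • (⊤ : Submodule (MvPolynomial (Fin n) K) F)).comap N.subtype ≤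
      irrelevant K n • ⊤) : N = ⊥ :=
  eq_bot_of_le_smul hF fun v hv =>
    (Submodule.mem_smul_top_iff _ N ⟨v, hv⟩).1 (h' (h hv))

theorem exact_subtype_rangeRestrict {F G H : Type*} [AddCommGroup F] [AddCommGroup G]
    [AddCommGroup H] [Module (MvPolynomial (Fin n) K) F] [Module (MvPolynomial (Fin n) K) G]
    [Module (MvPolynomial (Fin n) K) H] {α : F →ₗ[MvPolynomial (Fin n) K] G}
    {β : G →ₗ[MvPolynomial (Fin n) K] H} (h : Function.Exact α β) :
    Function.Exact (LinearMap.range α).subtype β.rangeRestrict := by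
  rw [LinearMap.exact_iff, LinearMap.ker_rangeRestrict, Submodule.range_subtype]
  exact h.linearMap_ker_eq

theorem hasProjectiveDimensionLT_range {F G H : Type u} [AddCommGroup F] [AddCommGroup G]
    [AddCommGroup H] [Module (MvPolynomial (Fin n) K) F] [Module (MvPolynomial (Fin n) K) G]
    [Module (MvPolynomial (Fin n) K) H] [Module.Projective (MvPolynomial (Fin n) K) G]
    {α : F →ₗ[MvPolynomial (Fin n) K] G}
    {β : G →ₗ[MvPolynomial (Fin n) K] H} (h : Function.Exact α β) {k : ℕ}
    (hk : HasProjectiveDimensionLT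
      (ModuleCat.of (MvPolynomial (Fin n) K) (LinearMap.range α)) k) :
    HasProjectiveDimensionLT (ModuleCat.of (MvPolynomial (Fin n) K) (LinearMap.range β))
      (k + 1) := by
  refine hasProjectiveDimensionLT_of_surjective β.surjective_rangeRestrict ?_
  rwa [LinearMap.ker_rangeRestrict, h.linearMap_ker_eq]

theorem map_rangeRestrict_smul_top {G H : Type*} [AddCommGroup G]
    [AddCommGroup H] [Module (MvPolynomial (Fin n) K) G]
    [Module (MvPolynomial (Fin n) K) H] (J : Ideal (MvPolynomial (Fin n) K))
    (β : G →ₗ[MvPolynomial (Fin n) K] H) :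
    (J • (⊤ : Submodule (MvPolynomial (Fin n) K) G)).map β.rangeRestrict = J • ⊤ := by
  rw [Submodule.map_smul'', Submodule.map_top, LinearMap.range_rangeRestrict]

section LinearResolution

variable {b : ℕ → ℕ} {d : ℕ} {g : Fin (b 0) → MvPolynomial (Fin n) K}
  {A : (i : ℕ) → Matrix (Fin (b i)) (Fin (b (i + 1))) (MvPolynomial (Fin n) K)}

theorem separating_pi {b : ℕ} (v : Fin b → MvPolynomial (Fin n) K)
    (h : ∀ l : (Fin b → MvPolynomial (Fin n) K) →ₗ[MvPolynomial (Fin n) K] MvPolynomial (Fin n) K,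
      l v = 0) : v = 0 :=
  funext fun q => h (LinearMap.proj q)

theorem range_mulVecLin_le {b c : ℕ} {B : Matrix (Fin b) (Fin c) (MvPolynomial (Fin n) K)}
    (hB : ∀ p q, (B p q).IsHomogeneous 1) :
    LinearMap.range B.mulVecLin ≤ irrelevant K n • ⊤ := by
  rintro _ ⟨v, rfl⟩
  refine mem_smul_top_pi fun q => ?_
  rw [Matrix.mulVecLin_apply, Matrix.mulVec, dotProduct]
  refine sum_mem fun p _ => Ideal.mul_mem_right _ _ ?_
  simpa using mem_irrelevant_pow_of_isHomogeneous (hB q p)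

/-- A submodule generated by vectors of linear forms meets `𝔪² F` only in its multiples by `𝔪`. -/
theorem comap_range_mulVecLin_le {b c : ℕ} {B : Matrix (Fin b) (Fin c) (MvPolynomial (Fin n) K)}
    (hB : ∀ p q, (B p q).IsHomogeneous 1) :
    (irrelevant K n • irrelevant K n • ⊤ : Submodule _ _).comap
      (LinearMap.range B.mulVecLin).subtype ≤ irrelevant K n • ⊤ := by
  rintro ⟨w, hw⟩ hv
  rw [Submodule.mem_smul_top_iff]
  replace hv : w ∈ irrelevant K n • irrelevant K n •
    (⊤ : Submodule (MvPolynomial (Fin n) K) _) := hv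
  change w ∈ _
  obtain ⟨v, rfl⟩ := hw
  rw [← Submodule.mul_smul, ← pow_two] at hv
  have h1 : B.mulVecLin (fun q => v q - C (coeff 0 (v q))) = B.mulVecLin v := by
    funext p
    have h2 : ∑ q, v q * B p q ∈ irrelevant K n ^ (1 + 1) := by
      have := map_mem_of_mem_smul_top (LinearMap.proj p) hv
      simpa [Matrix.mulVec, dotProduct, mul_comm] using this
    simpa [Matrix.mulVec, dotProduct, mul_comm] using sum_sub_constantCoeff (hB p) h2
  rw [← h1]
  exact map_mem_smul_range _ fun q => mem_irrelevant_iff.2 (by simp)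

theorem range_linearCombination_comap_le (hg : ∀ j, (g j).IsHomogeneous d) :
    Submodule.comap (LinearMap.range (Fintype.linearCombination (MvPolynomial (Fin n) K) g)).subtype
      (irrelevant K n • (irrelevant K n ^ d : Ideal (MvPolynomial (Fin n) K))) ≤
      irrelevant K n • ⊤ := by
  rintro ⟨w, hw⟩ hv
  rw [Submodule.mem_smul_top_iff]
  replace hv : w ∈ irrelevant K n * irrelevant K n ^ d := hv
  change w ∈ _
  obtain ⟨v, rfl⟩ := hw
  rw [← pow_succ'] at hv
  have h1 : Fintype.linearCombination (MvPolynomial (Fin n) K) g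
      (fun q => v q - C (coeff 0 (v q))) =
        Fintype.linearCombination (MvPolynomial (Fin n) K) g v :=
    sum_sub_constantCoeff hg hv
  rw [← h1]
  exact map_mem_smul_range _ fun q => mem_irrelevant_iff.2 (by simp)

theorem koszulVanishes_syzygy (hA : ∀ i p q, (A i p q).IsHomogeneous 1)
    (hex : ∀ i, Function.Exact (A (i + 1)).mulVecLin (A i).mulVecLin) (j i : ℕ) :
    KoszulVanishes (varSeq K n) n j
      (irrelevant K n • (⊤ : Submodule _ (LinearMap.range (A i).mulVecLin))) := by
  induction j generalizing i with
  | zero =>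
    rw [← map_rangeRestrict_smul_top]
    refine KoszulVanishes.zero_of_exact (exact_subtype_rangeRestrict (hex i)) ?_
      (koszulVanishes_of_projective _)
    rw [initialIdeal_varSeq_self]
    exact comap_range_mulVecLin_le (hA _)
  | succ j ih =>
    rw [← map_rangeRestrict_smul_top]
    refine KoszulVanishes.succ_of_exact (Submodule.subtype_injective _)
      (exact_subtype_rangeRestrict (hex i)) ?_ (ih (i + 1)) (koszulVanishes_of_projective _)
    rw [initialIdeal_varSeq_self]
    exact comap_range_mulVecLin_le (hA _)

theorem hasProjectiveDimensionLT_syzygy (hA : ∀ i p q, (A i p q).IsHomogeneous 1)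
    (hex : ∀ i, Function.Exact (A (i + 1)).mulVecLin (A i).mulVecLin) (j i : ℕ)
    (h : KoszulVanishes (varSeq K n) n j (⊤ : Submodule _ (LinearMap.range (A i).mulVecLin))) :
    HasProjectiveDimensionLT
      (ModuleCat.of (MvPolynomial (Fin n) K) (LinearMap.range (A i).mulVecLin)) (j + 1) := by
  induction j generalizing i with
  | zero =>
    refine hasProjectiveDimensionLT_range (hex i) (hasProjectiveDimensionLT_zero_of_eq_bot ?_)
    refine eq_bot_of_comap_le separating_pi (range_mulVecLin_le (hA _)) ?_
    rw [← initialIdeal_varSeq_self]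
    exact h.comap_le_of_exact (Submodule.subtype_injective _)
      (exact_subtype_rangeRestrict (hex i)) (LinearMap.surjective_rangeRestrict _)
  | succ j ih =>
    exact hasProjectiveDimensionLT_range (hex i) (ih _ (h.pred_of_exact
      (Submodule.subtype_injective _) (exact_subtype_rangeRestrict (hex i))
      (LinearMap.surjective_rangeRestrict _) (koszulVanishes_of_projective _)))

end LinearResolution

variable {I : Ideal (MvPolynomial (Fin n) K)} {d : ℕ}

/-- Koszul cycles of `S / I` of internal degree at least `d` bound: the Koszul homology of an ideal
with `d`-linear resolution sits in the linear strand. -/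
theorem HasLinearResolution.koszulVanishes_quotient (hI : HasLinearResolution I d) (j : ℕ) :
    KoszulVanishes (varSeq K n) n j
      (Submodule.map I.mkQ (irrelevant K n ^ d : Ideal (MvPolynomial (Fin n) K))) := by
  obtain ⟨b, g, A, hg, hA, hspan, hex0, hex⟩ := hI
  rw [Ideal.span, ← Fintype.range_linearCombination] at hspan
  subst hspan
  have hle := range_linearCombination_comap_le hg
  cases j with
  | zero =>
    exact KoszulVanishes.zero_of_exact (mkQ_exact _)
      (by rwa [initialIdeal_varSeq_self]) (koszulVanishes_of_projective _)
  | succ j =>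
    refine KoszulVanishes.succ_of_exact (Q' := irrelevant K n • ⊤)
      (Submodule.subtype_injective _) (mkQ_exact _) (by rwa [initialIdeal_varSeq_self]) ?_
      (koszulVanishes_of_projective _)
    rw [← map_rangeRestrict_smul_top]
    cases j with
    | zero =>
      refine KoszulVanishes.zero_of_exact (exact_subtype_rangeRestrict hex0) ?_
        (koszulVanishes_of_projective _)
      rw [initialIdeal_varSeq_self]
      exact comap_range_mulVecLin_le (hA _)
    | succ j =>
      refine KoszulVanishes.succ_of_exact (Submodule.subtype_injective _)
        (exact_subtype_rangeRestrict hex0) ?_ (koszulVanishes_syzygy hA hex _ _)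
        (koszulVanishes_of_projective _)
      rw [initialIdeal_varSeq_self]
      exact comap_range_mulVecLin_le (hA _)

/-- Since a linear resolution is minimal, it is no longer than the Koszul homology of `S / I`
demands. -/
theorem HasLinearResolution.hasProjectiveDimensionLT (hI : HasLinearResolution I d)
    (hm : I ≤ irrelevant K n) {k : ℕ}
    (h : KoszulVanishes (varSeq K n) n k
      (⊤ : Submodule (MvPolynomial (Fin n) K) (MvPolynomial (Fin n) K ⧸ I))) :
    HasProjectiveDimensionLT (ModuleCat.of (MvPolynomial (Fin n) K) I) k := by
  obtain ⟨b, g, A, hg, hA, hspan, hex0, hex⟩ := hI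
  rw [Ideal.span, ← Fintype.range_linearCombination] at hspan
  subst hspan
  cases k with
  | zero =>
    refine hasProjectiveDimensionLT_zero_of_eq_bot (eq_bot_of_comap_le
      (fun v hv => hv LinearMap.id) (by simpa using hm) ?_)
    rw [← initialIdeal_varSeq_self]
    exact h.comap_le_of_exact (Submodule.subtype_injective _) (mkQ_exact _)
      (Submodule.mkQ_surjective _)
  | succ k =>
    have h1 := h.pred_of_exact (Submodule.subtype_injective _) (mkQ_exact _)
      (Submodule.mkQ_surjective _) (koszulVanishes_of_projective _)
    refine hasProjectiveDimensionLT_range hex0 ?_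
    cases k with
    | zero =>
      refine hasProjectiveDimensionLT_zero_of_eq_bot ?_
      refine eq_bot_of_comap_le separating_pi (range_mulVecLin_le (hA _)) ?_
      rw [← initialIdeal_varSeq_self]
      exact h1.comap_le_of_exact (Submodule.subtype_injective _)
        (exact_subtype_rangeRestrict hex0) (LinearMap.surjective_rangeRestrict _)
    | succ k =>
      exact hasProjectiveDimensionLT_syzygy hA hex _ _ (h1.pred_of_exact
        (Submodule.subtype_injective _) (exact_subtype_rangeRestrict hex0)
        (LinearMap.surjective_rangeRestrict _) (koszulVanishes_of_projective _))

end

section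

/-! ### Monomial ideals and their socles -/

theorem mem_monomialSpan {A : Set (Fin n →₀ ℕ)} {p : MvPolynomial (Fin n) K} :
    p ∈ monomialSpan K A ↔ ∀ a ∈ p.support, ∃ b ∈ A, b ≤ a :=
  mem_ideal_span_monomial_image

theorem monomial_mem_monomialSpan {A : Set (Fin n →₀ ℕ)} {a : Fin n →₀ ℕ} :
    monomial a (1 : K) ∈ monomialSpan K A ↔ ∃ b ∈ A, b ≤ a := by
  classical
  rw [mem_monomialSpan, support_monomial, if_neg one_ne_zero]
  simp

theorem monomial_mem_of_le {I : Ideal (MvPolynomial (Fin n) K)} {a b : Fin n →₀ ℕ}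
    (h : monomial a (1 : K) ∈ I) (hab : a ≤ b) : monomial b (1 : K) ∈ I := by
  obtain ⟨c, rfl⟩ := exists_add_of_le hab
  rw [show monomial (a + c) (1 : K) = monomial a 1 * monomial c 1 by simp]
  exact Ideal.mul_mem_right _ _ h

theorem eq_of_mem_minGens {I : Ideal (MvPolynomial (Fin n) K)} {a b : Fin n →₀ ℕ}
    (ha : a ∈ minGens I) (hb : monomial b (1 : K) ∈ I) (h : b ≤ a) : a = b :=
  le_antisymm (ha.2 hb h) h

theorem exists_minGens_le {I : Ideal (MvPolynomial (Fin n) K)} {a : Fin n →₀ ℕ}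
    (h : monomial a (1 : K) ∈ I) : ∃ b ∈ minGens I, b ≤ a := by
  obtain ⟨b, hb, hb'⟩ := exists_minimal_le_of_wellFoundedLT
    (fun b : Fin n →₀ ℕ => monomial b (1 : K) ∈ I) a h
  exact ⟨b, hb', hb⟩

theorem monomial_mem_iff_exists_minGens {I : Ideal (MvPolynomial (Fin n) K)} {a : Fin n →₀ ℕ} :
    monomial a (1 : K) ∈ I ↔ ∃ b ∈ minGens I, b ≤ a :=
  ⟨exists_minGens_le, fun ⟨_, hb, hba⟩ => monomial_mem_of_le hb.1 hba⟩

namespace IsMonomialIdeal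

variable {I J : Ideal (MvPolynomial (Fin n) K)}

theorem mem_iff (hI : IsMonomialIdeal I) {p : MvPolynomial (Fin n) K} :
    p ∈ I ↔ ∀ a ∈ p.support, monomial a (1 : K) ∈ I := by
  obtain ⟨A, rfl⟩ := hI
  simp only [monomial_mem_monomialSpan, mem_monomialSpan (p := p)]

theorem le_iff (hI : IsMonomialIdeal I) {J : Ideal (MvPolynomial (Fin n) K)} :
    I ≤ J ↔ ∀ a : Fin n →₀ ℕ, monomial a (1 : K) ∈ I → monomial a (1 : K) ∈ J := by
  refine ⟨fun h a ha => h ha, fun h => ?_⟩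
  obtain ⟨A, rfl⟩ := hI
  refine Ideal.span_le.2 ?_
  rintro _ ⟨a, ha, rfl⟩
  exact h a (Ideal.subset_span ⟨a, ha, rfl⟩)

theorem of_mem_iff (h : ∀ p ∈ I, ∀ a ∈ p.support, monomial a (1 : K) ∈ I) :
    IsMonomialIdeal I := by
  refine ⟨{a | monomial a (1 : K) ∈ I}, le_antisymm (fun p hp => ?_) ?_⟩
  · exact mem_monomialSpan.2 fun a ha => ⟨a, h p hp a ha, le_rfl⟩
  · refine Ideal.span_le.2 ?_
    rintro _ ⟨a, ha, rfl⟩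
    exact ha

theorem eq_monomialSpan_minGens (hI : IsMonomialIdeal I) : I = monomialSpan K (minGens I) := by
  ext p
  rw [hI.mem_iff, mem_monomialSpan]
  simp only [monomial_mem_iff_exists_minGens]

theorem monomial_mem_sup (hI : IsMonomialIdeal I) (hJ : IsMonomialIdeal J) {a : Fin n →₀ ℕ} :
    monomial a (1 : K) ∈ I ⊔ J ↔ monomial a (1 : K) ∈ I ∨ monomial a (1 : K) ∈ J := by
  refine ⟨fun h => ?_, fun h => h.elim (fun h => Ideal.mem_sup_left h)
    fun h => Ideal.mem_sup_right h⟩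
  obtain ⟨A, rfl⟩ := hI
  obtain ⟨B, rfl⟩ := hJ
  rw [monomialSpan, monomialSpan, ← Ideal.span_union, ← Set.image_union] at h
  obtain ⟨b, hb, hba⟩ := monomial_mem_monomialSpan.1 h
  exact hb.imp (fun hb => monomial_mem_monomialSpan.2 ⟨b, hb, hba⟩)
    fun hb => monomial_mem_monomialSpan.2 ⟨b, hb, hba⟩

theorem colon_irrelevant (hI : IsMonomialIdeal I) :
    IsMonomialIdeal (I.colon (irrelevant K n)) := by
  refine of_mem_iff fun p hp a ha => ?_
  rw [mem_colon_irrelevant] at hp ⊢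
  intro i
  have := hI.mem_iff.1 (hp i) _ (support_X_mul_iff.2 ha)
  rwa [X, monomial_mul, one_mul, add_comm]

end IsMonomialIdeal

theorem monomial_mem_colon_irrelevant {I : Ideal (MvPolynomial (Fin n) K)} {a : Fin n →₀ ℕ} :
    monomial a (1 : K) ∈ I.colon (irrelevant K n) ↔
      ∀ i, monomial (a + Finsupp.single i 1) (1 : K) ∈ I := by
  rw [mem_colon_irrelevant]
  simp only [X, monomial_mul, one_mul, add_comm]

theorem le_colon_irrelevant (I : Ideal (MvPolynomial (Fin n) K)) :
    I ≤ I.colon (irrelevant K n) := fun _ hp =>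
  mem_colon_irrelevant.2 fun _ => Ideal.mul_mem_left _ _ hp

theorem degree_add_single (a : Fin n →₀ ℕ) (i : Fin n) :
    (a + Finsupp.single i 1).degree = a.degree + 1 := by
  simp [Finsupp.degree_single]

theorem eq_of_le_of_degree_eq {a b : Fin n →₀ ℕ} (h : a ≤ b) (hd : a.degree = b.degree) :
    a = b := by
  obtain ⟨c, rfl⟩ := exists_add_of_le h
  rw [map_add] at hd
  have : c = 0 := (Finsupp.degree_eq_zero_iff c).1 (by omega)
  simp [this]

section Socle

variable {I : Ideal (MvPolynomial (Fin n) K)} {d : ℕ}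

theorem Equigenerated.le_degree (hd : Equigenerated I d) {a : Fin n →₀ ℕ}
    (ha : monomial a (1 : K) ∈ I) : d ≤ a.degree := by
  obtain ⟨b, hb, hba⟩ := exists_minGens_le ha
  exact hd b hb ▸ Finsupp.degree_mono hba

theorem Equigenerated.mem_minGens_iff (hd : Equigenerated I d) {a : Fin n →₀ ℕ} :
    a ∈ minGens I ↔ monomial a (1 : K) ∈ I ∧ a.degree = d := by
  refine ⟨fun h => ⟨h.1, hd a h⟩, fun ⟨h, h'⟩ => ?_⟩
  obtain ⟨b, hb, hba⟩ := exists_minGens_le h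
  rwa [← eq_of_le_of_degree_eq hba (by rw [hd b hb, h'])]

theorem minGens_monomialSpan_of_degree {A : Set (Fin n →₀ ℕ)} {e : ℕ}
    (hA : ∀ a ∈ A, a.degree = e) : minGens (monomialSpan K A) = A := by
  ext a
  constructor
  · intro ha
    obtain ⟨b, hb, hba⟩ := monomial_mem_monomialSpan.1 ha.1
    have := eq_of_mem_minGens ha (monomial_mem_monomialSpan.2 ⟨b, hb, le_rfl⟩) hba
    rwa [this]
  · intro ha
    refine ⟨monomial_mem_monomialSpan.2 ⟨a, ha, le_rfl⟩, fun b hb hba => ?_⟩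
    obtain ⟨c, hc, hcb⟩ := monomial_mem_monomialSpan.1 hb
    exact (eq_of_le_of_degree_eq (hcb.trans hba) (by rw [hA _ hc, hA _ ha])) ▸ hcb

/-- For equigenerated ideals the generators of the socle ideal are simply the monomials of degree
`d - 1` in `I : 𝔪`; minimality is automatic. -/
theorem mem_minGens_soc_iff (hn : 1 ≤ n) (hd : Equigenerated I d) {w : Fin n →₀ ℕ} :
    w ∈ minGens (soc I d) ↔
      (∀ i, monomial (w + Finsupp.single i 1) (1 : K) ∈ I) ∧ w.degree + 1 = d := by
  rw [soc, minGens_monomialSpan_of_degree (e := d - 1) (by rintro a ⟨-, ha⟩; omega),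
    Set.mem_ofPred_eq, ← monomial_mem_colon_irrelevant]
  refine and_congr_left fun hw => ⟨fun h => h.1, fun h => ⟨h, fun b hb hbw => ?_⟩⟩
  have h1 := hd.le_degree (monomial_mem_colon_irrelevant.1 hb ⟨0, hn⟩)
  rw [degree_add_single] at h1
  have h2 := Finsupp.degree_mono hbw
  exact (eq_of_le_of_degree_eq hbw (by omega)).ge

theorem isMonomialIdeal_soc : IsMonomialIdeal (soc I d) := ⟨_, rfl⟩

theorem minGens_nonempty_iff (hI : IsMonomialIdeal I) : (minGens I).Nonempty ↔ I ≠ ⊥ := by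
  rw [Set.nonempty_iff_ne_empty, not_iff_not]
  refine ⟨fun h => ?_, fun h => ?_⟩
  · rw [hI.eq_monomialSpan_minGens, h, monomialSpan, Set.image_empty, Ideal.span_empty]
  · subst h
    refine Set.eq_empty_of_forall_notMem fun a ha => ?_
    have := ha.1
    simp at this

/-- The condition on `I` that makes the socle ideal behave: each monomial of `(I : 𝔪) \ I` has
degree `d - 1`. -/
def SocleInDegree (I : Ideal (MvPolynomial (Fin n) K)) (d : ℕ) : Prop :=
  ∀ w : Fin n →₀ ℕ, (∀ i, monomial (w + Finsupp.single i 1) (1 : K) ∈ I) →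
    monomial w (1 : K) ∉ I → w.degree + 1 = d

theorem colon_irrelevant_eq_soc_sup (hn : 1 ≤ n) (hI : IsMonomialIdeal I)
    (hd : Equigenerated I d) (hs : SocleInDegree I d) :
    I.colon (irrelevant K n) = soc I d ⊔ I := by
  refine le_antisymm (hI.colon_irrelevant.le_iff.2 fun a ha => ?_)
    (sup_le (isMonomialIdeal_soc.le_iff.2 fun a ha => ?_) (le_colon_irrelevant I))
  · rw [isMonomialIdeal_soc.monomial_mem_sup hI, or_iff_not_imp_right]
    intro h
    rw [monomial_mem_colon_irrelevant] at ha
    exact ((mem_minGens_soc_iff hn hd).2 ⟨ha, hs a ha h⟩).1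
  · obtain ⟨b, hb, hba⟩ := exists_minGens_le ha
    exact monomial_mem_of_le
      (monomial_mem_colon_irrelevant.2 ((mem_minGens_soc_iff hn hd).1 hb).1) hba

theorem isSocleIdeal_iff (hn : 1 ≤ n) (hI : IsMonomialIdeal I)
    (hd : Equigenerated I d) (hs : SocleInDegree I d) (J : Ideal (MvPolynomial (Fin n) K)) :
    IsSocleIdeal I d J ↔ J = soc I d := by
  constructor
  · rintro ⟨hJ, hJd, hJI⟩
    rw [hJ.eq_monomialSpan_minGens, isMonomialIdeal_soc.eq_monomialSpan_minGens]
    congr 1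
    ext w
    rw [mem_minGens_soc_iff hn hd, ← monomial_mem_colon_irrelevant, hJI,
      hJ.monomial_mem_sup hI]
    refine ⟨fun hw => ⟨Or.inl hw.1, hJd w hw⟩, ?_⟩
    rintro ⟨hw | hw, hwd⟩
    · obtain ⟨b, hb, hbw⟩ := exists_minGens_le hw
      have := hJd b hb
      rwa [← eq_of_le_of_degree_eq hbw (by omega)]
    · have := hd.le_degree hw
      omega
  · rintro rfl
    exact ⟨isMonomialIdeal_soc, fun w hw => ((mem_minGens_soc_iff hn hd).1 hw).2,
      colon_irrelevant_eq_soc_sup hn hI hd hs⟩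

theorem soc_ne_bot_iff (hn : 1 ≤ n) (hI : IsMonomialIdeal I)
    (hd : Equigenerated I d) (hs : SocleInDegree I d) :
    soc I d ≠ ⊥ ↔ ¬ I.colon (irrelevant K n) ≤ I := by
  rw [colon_irrelevant_eq_soc_sup hn hI hd hs]
  refine ⟨fun h h' => ?_, fun h h' => h (by rw [h', bot_sup_eq])⟩
  obtain ⟨w, hw⟩ := (minGens_nonempty_iff isMonomialIdeal_soc).2 h
  have h1 := hd.le_degree (h' (Ideal.mem_sup_left hw.1))
  have h2 := ((mem_minGens_soc_iff hn hd).1 hw).2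
  omega

theorem ne_bot_of_supp (hn : 1 ≤ n) (h : supp I = Set.univ) : I ≠ ⊥ := by
  rintro rfl
  obtain ⟨a, ha, -⟩ : (⟨0, hn⟩ : Fin n) ∈ supp (⊥ : Ideal (MvPolynomial (Fin n) K)) :=
    h ▸ Set.mem_univ _
  have := ha.1
  simp at this

theorem Equigenerated.one_le (hd : Equigenerated I d) (hn : 1 ≤ n) (h : supp I = Set.univ) :
    1 ≤ d := by
  obtain ⟨a, ha, ha'⟩ : (⟨0, hn⟩ : Fin n) ∈ supp I := h ▸ Set.mem_univ _
  rw [← hd a ha, Nat.one_le_iff_ne_zero]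
  exact fun h0 => ha' (by rw [(Finsupp.degree_eq_zero_iff a).1 h0]; rfl)

theorem Equigenerated.le_irrelevant_pow (hI : IsMonomialIdeal I) (hd : Equigenerated I d) :
    I ≤ irrelevant K n ^ d := by
  refine hI.le_iff.2 fun a ha => ?_
  rw [mem_irrelevant_pow_iff]
  intro b hb
  rw [coeff_monomial, if_neg]
  rintro rfl
  exact absurd (hd.le_degree ha) (by omega)

end Socle

/-! ### Monomial ideals with linear resolution -/

section

variable {I : Ideal (MvPolynomial (Fin n) K)} {d : ℕ}

theorem HasLinearResolution.equigenerated (hI : IsMonomialIdeal I)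
    (h : HasLinearResolution I d) : Equigenerated I d := by
  obtain ⟨b, g, -, hg, -, hspan, -, -⟩ := h
  intro a ha
  have hle : I ≤ monomialSpan K {c | monomial c (1 : K) ∈ I ∧ c.degree = d} := by
    conv_lhs => rw [← hspan]
    refine Ideal.span_le.2 ?_
    rintro _ ⟨j, rfl⟩
    refine mem_monomialSpan.2 fun c hc => ⟨c, ⟨?_, ?_⟩, le_rfl⟩
    · exact hI.mem_iff.1 (hspan ▸ Ideal.subset_span ⟨j, rfl⟩) c hc
    · by_contra h
      exact mem_support_iff.1 hc ((hg j).coeff_eq_zero h)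
  obtain ⟨c, ⟨hc, hcd⟩, hca⟩ := monomial_mem_monomialSpan.1 (hle ha.1)
  rwa [eq_of_mem_minGens ha hc hca]

theorem HasLinearResolution.socleInDegree (hn : 1 ≤ n) (hI : IsMonomialIdeal I)
    (h : HasLinearResolution I d) : SocleInDegree I d := by
  intro w hw hwI
  have h1 := (h.equigenerated hI).le_degree (hw ⟨0, hn⟩)
  rw [degree_add_single] at h1
  by_contra hne
  refine hwI (mem_of_koszulVanishes (Nat.sub_add_cancel hn) (h.koszulVanishes_quotient _)
    (monomial_mem_colon_irrelevant.2 hw) (Submodule.mem_map_of_mem ?_))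
  rw [mem_irrelevant_pow_iff]
  intro b hb
  rw [coeff_monomial, if_neg]
  rintro rfl
  omega

theorem HasLinearResolution.pd_eq_iff (hn : 1 ≤ n) (hI : IsMonomialIdeal I)
    (h : HasLinearResolution I d) (hsupp : supp I = Set.univ) :
    pd I = ((n - 1 : ℕ) : WithBot ℕ∞) ↔ soc I d ≠ ⊥ := by
  have hd := h.equigenerated hI
  have hm : I ≤ irrelevant K n := (hd.le_irrelevant_pow hI).trans
    (Ideal.pow_le_self (by have := hd.one_le hn hsupp; omega))
  rw [soc_ne_bot_iff hn hI hd (h.socleInDegree hn hI)]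
  exact pd_eq_iff_not_colon_le hn (ne_bot_of_supp hn hsupp)
    (h.hasProjectiveDimensionLT hm (koszulVanishes_of_le le_rfl _))
    fun hle => h.hasProjectiveDimensionLT hm
      (MonIdeal.koszulVanishes_quotient (Nat.sub_add_cancel hn) hle)

end

end

section

/-! ### Linear quotients -/

/-- The exact sequence `0 → J : u → J × S → J + (u) → 0` bounds the projective dimension of
`J + (u)`. -/
theorem hasProjectiveDimensionLT_sup_span {J : Ideal (MvPolynomial (Fin n) K)}
    {p : MvPolynomial (Fin n) K} {k : ℕ}
    (h1 : HasProjectiveDimensionLT (ModuleCat.of (MvPolynomial (Fin n) K) (J.colon {p})) k)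
    (h2 : HasProjectiveDimensionLT (ModuleCat.of (MvPolynomial (Fin n) K) J) (k + 1)) :
    HasProjectiveDimensionLT
      (ModuleCat.of (MvPolynomial (Fin n) K) (J ⊔ Ideal.span {p} : Ideal _)) (k + 1) := by
  let φ : (J × MvPolynomial (Fin n) K) →ₗ[MvPolynomial (Fin n) K] MvPolynomial (Fin n) K :=
    LinearMap.coprod J.subtype (LinearMap.toSpanSingleton _ _ p)
  have hφ : LinearMap.range φ = J ⊔ Ideal.span {p} := by
    rw [LinearMap.range_coprod, Submodule.range_subtype, LinearMap.range_toSpanSingleton]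
  let f : J.colon {p} →ₗ[MvPolynomial (Fin n) K] (J × MvPolynomial (Fin n) K) :=
    LinearMap.prod
      (-(((LinearMap.toSpanSingleton _ _ p).domRestrict (J.colon {p})).codRestrict J
        fun c => Submodule.mem_colon_singleton.1 c.2)) (Submodule.subtype _)
  have hS : HasProjectiveDimensionLT
      (ModuleCat.of (MvPolynomial (Fin n) K) (MvPolynomial (Fin n) K)) (k + 1) := by
    have : Projective (ModuleCat.of (MvPolynomial (Fin n) K) (MvPolynomial (Fin n) K)) :=
      (IsProjective.iff_projective (R := MvPolynomial (Fin n) K) _).1 inferInstance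
    exact hasProjectiveDimensionLT_of_ge _ 1 _ (by omega)
  have hprod : HasProjectiveDimensionLT
      (ModuleCat.of (MvPolynomial (Fin n) K) (J × MvPolynomial (Fin n) K)) (k + 1) :=
    hasProjectiveDimensionLT_of_iso
      (ModuleCat.biprodIsoProd (ModuleCat.of _ J) (ModuleCat.of _ (MvPolynomial (Fin n) K))) _
  have hex : Function.Exact f φ.rangeRestrict := by
    rw [LinearMap.exact_iff, LinearMap.ker_rangeRestrict]
    ext ⟨a, c⟩
    rw [LinearMap.mem_ker, LinearMap.mem_range]
    constructor
    · intro h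
      have h' : (a : MvPolynomial (Fin n) K) + c * p = 0 := h
      refine ⟨⟨c, Submodule.mem_colon_singleton.2 ?_⟩, Prod.ext (Subtype.ext ?_) rfl⟩
      · rw [smul_eq_mul, eq_neg_of_add_eq_zero_right h']
        exact neg_mem a.2
      · exact (eq_neg_of_add_eq_zero_left h').symm
    · rintro ⟨y, hy⟩
      obtain ⟨rfl, rfl⟩ := Prod.ext_iff.1 hy
      exact neg_add_cancel _
  have hse := ModuleCat.shortComplex_shortExact
    (ShortComplex.mk (ModuleCat.ofHom f) (ModuleCat.ofHom φ.rangeRestrict)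
      (by ext1; exact hex.linearMap_comp_eq_zero)) hex
    (fun a b h => Subtype.ext (congrArg Prod.snd h)) φ.surjective_rangeRestrict
  have := hse.hasProjectiveDimensionLT_X₃ k h1 hprod
  rw [← hφ]
  exact this

theorem hasProjectiveDimensionLT_span_X (s : Finset (Fin n)) :
    HasProjectiveDimensionLT (ModuleCat.of (MvPolynomial (Fin n) K)
      (Ideal.span (X '' (s : Set (Fin n))) : Ideal (MvPolynomial (Fin n) K))) s.card := by
  induction s using Finset.induction_on with
  | empty => exact hasProjectiveDimensionLT_zero_of_eq_bot (by simp)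
  | insert i s hi ih =>
    rw [Finset.card_insert_of_notMem hi, Finset.coe_insert, Set.image_insert_eq, Ideal.span_insert,
      sup_comm]
    have hcolon : (Ideal.span (X '' (s : Set (Fin n))) : Ideal (MvPolynomial (Fin n) K)).colon
        {X i} = Ideal.span (X '' (s : Set (Fin n))) := by
      refine le_antisymm (fun p hp => ?_) Ideal.le_colon
      rw [Submodule.mem_colon_singleton, smul_eq_mul, mul_comm] at hp
      exact mem_span_X_of_X_mul_mem (by simpa using hi) hp
    exact hasProjectiveDimensionLT_sup_span (by rwa [hcolon])
      (hasProjectiveDimensionLT_of_ge _ s.card _ (by omega))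

variable {I : Ideal (MvPolynomial (Fin n) K)} {d : ℕ} {m : MonomialOrder (Fin n)}

/-- The largest minimal generator of `I`, with respect to `m`, dividing a given monomial. -/
def IsLeadGen (I : Ideal (MvPolynomial (Fin n) K)) (m : MonomialOrder (Fin n))
    (u a : Fin n →₀ ℕ) : Prop :=
  u ∈ minGens I ∧ u ≤ a ∧ ∀ b ∈ minGens I, b ≤ a → m.toSyn b ≤ m.toSyn u

theorem exists_isLeadGen (m : MonomialOrder (Fin n)) {a : Fin n →₀ ℕ}
    (ha : monomial a (1 : K) ∈ I) : ∃ u, IsLeadGen I m u a := by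
  have hfin : {b | b ∈ minGens I ∧ b ≤ a}.Finite := (Set.finite_Iic a).subset fun b hb => hb.2
  obtain ⟨u, hu, hmax⟩ := Set.exists_max_image _ m.toSyn hfin (exists_minGens_le ha)
  exact ⟨u, hu.1, hu.2, fun b hb hba => hmax b ⟨hb, hba⟩⟩

theorem IsLeadGen.unique {u v a : Fin n →₀ ℕ} (hu : IsLeadGen I m u a) (hv : IsLeadGen I m v a) :
    u = v :=
  m.toSyn.injective (le_antisymm (hv.2.2 u hu.1 hu.2.1) (hu.2.2 v hv.1 hv.2.1))

/-- The variables in the colon ideal of the larger generators by `u`. They are encoded as those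
`x_i` for which `x_i u` is divisible by a generator larger than `u`; for linear quotients,
they generate the colon ideal. -/
def colonVars (I : Ideal (MvPolynomial (Fin n) K)) (m : MonomialOrder (Fin n))
    (u : Fin n →₀ ℕ) : Set (Fin n) :=
  {i | ¬ IsLeadGen I m u (Finsupp.single i 1 + u)}

theorem isLeadGen_add_iff_of_colon_eq {u : Fin n →₀ ℕ} (hu : u ∈ minGens I) {s : Set (Fin n)}
    (hs : (monomialSpan K {b | b ∈ minGens I ∧ m.toSyn u < m.toSyn b}).colon {monomial u (1 : K)} =
      Ideal.span (X '' s)) (c : Fin n →₀ ℕ) :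
    IsLeadGen I m u (c + u) ↔ ∀ i ∈ s, c i = 0 := by
  classical
  have h1 : monomial c (1 : K) ∈ Ideal.span (X '' s : Set (MvPolynomial (Fin n) K)) ↔
      ∃ i ∈ s, c i ≠ 0 := by
    rw [mem_ideal_span_X_image, support_monomial, if_neg one_ne_zero]
    simp
  rw [← hs, Submodule.mem_colon_singleton, smul_eq_mul, monomial_mul, one_mul,
    monomial_mem_monomialSpan] at h1
  rw [← not_iff_not]
  push Not
  rw [← h1]
  constructor
  · intro h
    by_contra! h2
    refine h ⟨hu, le_add_self, fun b hb hbc => ?_⟩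
    by_contra! h3
    exact h2 b ⟨hb, h3⟩ hbc
  · rintro ⟨b, ⟨hb, hub⟩, hbc⟩ h
    exact absurd (h.2.2 b hb hbc) (not_le.2 hub)

namespace HasLinearQuotients

variable (hI : HasLinearQuotients I m)
include hI

theorem colon_eq {u : Fin n →₀ ℕ} (hu : u ∈ minGens I) :
    (monomialSpan K {b | b ∈ minGens I ∧ m.toSyn u < m.toSyn b}).colon {monomial u (1 : K)} =
      Ideal.span (X '' colonVars I m u) := by
  obtain ⟨s, hs⟩ := hI u hu
  rw [hs]
  congr 2
  ext i
  rw [colonVars, Set.mem_ofPred_eq, isLeadGen_add_iff_of_colon_eq hu hs]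
  simp [Finsupp.single_apply]

/-- Each monomial of `I` is uniquely `x^c u` with `u` a generator and `c` avoiding `colonVars u`,
and `u` is then the largest generator dividing it. -/
theorem isLeadGen_add_iff {u : Fin n →₀ ℕ} (hu : u ∈ minGens I) (c : Fin n →₀ ℕ) :
    IsLeadGen I m u (c + u) ↔ ∀ i ∈ colonVars I m u, c i = 0 :=
  isLeadGen_add_iff_of_colon_eq hu (hI.colon_eq hu) c

theorem isLeadGen_single_add {u c : Fin n →₀ ℕ} (h : IsLeadGen I m u (c + u)) {i : Fin n}
    (hi : i ∉ colonVars I m u) : IsLeadGen I m u (Finsupp.single i 1 + c + u) := by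
  have h' := (hI.isLeadGen_add_iff h.1 c).1 h
  rw [hI.isLeadGen_add_iff h.1]
  intro k hk
  have : i ≠ k := fun h => hi (h ▸ hk)
  simp [h' k hk, this]

end HasLinearQuotients

theorem exists_eq_single_of_degree_eq_one {c : Fin n →₀ ℕ} (h : c.degree = 1) :
    ∃ j, c = Finsupp.single j 1 := by
  have hc : c ≠ 0 := by
    rintro rfl
    simp at h
  obtain ⟨j, hj⟩ := Finsupp.ne_iff.1 hc
  exact ⟨j, (eq_of_le_of_degree_eq (Finsupp.single_le_iff.2 (Nat.one_le_iff_ne_zero.2 hj))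
    (by rw [Finsupp.degree_single, h])).symm⟩

/-- A larger generator `b` dividing `x_i u` is `x_i u / x_j` with `j > i`. -/
theorem exists_add_single_eq (hd : Equigenerated I d) (hm : InducedByVars m)
    {u b : Fin n →₀ ℕ} (hu : u ∈ minGens I) (hb : b ∈ minGens I) (hub : m.toSyn u < m.toSyn b)
    {i : Fin n} (h : b ≤ Finsupp.single i 1 + u) :
    ∃ j, i < j ∧ Finsupp.single j 1 + b = Finsupp.single i 1 + u := by
  obtain ⟨c, hc⟩ := exists_add_of_le h
  have hdeg : c.degree = 1 := by
    have := congrArg Finsupp.degree hc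
    rw [map_add, map_add, Finsupp.degree_single, hd u hu, hd b hb] at this
    omega
  obtain ⟨j, rfl⟩ := exists_eq_single_of_degree_eq_one hdeg
  refine ⟨j, ?_, by rw [hc, add_comm]⟩
  have h1 := congrArg m.toSyn hc
  rw [map_add, map_add] at h1
  have h2 : m.toSyn (Finsupp.single j 1) < m.toSyn (Finsupp.single i 1) := by
    by_contra! h3
    exact absurd h1 (ne_of_lt (by rw [add_comm (m.toSyn b)]; exact add_lt_add_of_le_of_lt h3 hub))
  rcases lt_trichotomy i j with h3 | rfl | h3
  · exact h3
  · exact absurd h2 (lt_irrefl _)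
  · exact absurd (hm j i h3) h2.asymm

theorem lastVar_notMem_colonVars (hn : 1 ≤ n) (hd : Equigenerated I d) (hm : InducedByVars m)
    {u : Fin n →₀ ℕ} (hu : u ∈ minGens I) : lastVar hn ∉ colonVars I m u := by
  intro h
  refine h ⟨hu, le_add_self, fun b hb hbu => ?_⟩
  by_contra! hlt
  obtain ⟨j, hj, -⟩ := exists_add_single_eq hd hm hu hb hlt hbu
  have : n - 1 < j.1 := hj
  omega

namespace HasLinearQuotients

variable (hI : HasLinearQuotients I m)
include hI

theorem socleInDegree (hn : 1 ≤ n) (hd : Equigenerated I d) (hm : InducedByVars m) :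
    SocleInDegree I d := by
  intro w hw hwI
  obtain ⟨u, hu⟩ := exists_isLeadGen m (hw (lastVar hn))
  obtain ⟨v, hv⟩ := exists_add_of_le hu.2.1
  rw [add_comm u] at hv
  have hvl : v (lastVar hn) = 0 := by
    by_contra h0
    refine hwI (monomial_mem_of_le hu.1.1 (?_ : u ≤ w))
    have h1 : Finsupp.single (lastVar hn) 1 ≤ v :=
      Finsupp.single_le_iff.2 (Nat.one_le_iff_ne_zero.2 h0)
    obtain ⟨v', rfl⟩ := exists_add_of_le h1
    rw [add_comm w, add_assoc] at hv
    rw [add_left_cancel hv]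
    exact le_add_self
  by_cases hv0 : v = 0
  · rw [hv0, zero_add] at hv
    rw [← degree_add_single w (lastVar hn), hv, hd u hu.1]
  exfalso
  obtain ⟨i, hi⟩ := Finsupp.ne_iff.1 hv0
  have hil : i ≠ lastVar hn := fun h => hi (h ▸ hvl)
  obtain ⟨u', hu'⟩ := exists_isLeadGen m (hw i)
  obtain ⟨v', hv'⟩ := exists_add_of_le hu'.2.1
  rw [add_comm u'] at hv'
  rw [hv] at hu
  rw [hv'] at hu'
  have hiu : i ∉ colonVars I m u := fun h => hi ((hI.isLeadGen_add_iff hu.1 v).1 hu i h)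
  -- Both `u` and `u'` are the leading generator of `x_i x_n w`.
  have h1 := hI.isLeadGen_single_add hu hiu
  have h2 := hI.isLeadGen_single_add hu' (lastVar_notMem_colonVars hn hd hm hu'.1)
  have h3 : Finsupp.single i 1 + v + u = Finsupp.single (lastVar hn) 1 + v' + u' := by
    rw [add_assoc, ← hv, add_assoc, ← hv']
    abel
  rw [← h3] at h2
  obtain rfl := h1.unique h2
  have h4 := DFunLike.congr_fun (add_right_cancel h3) (lastVar hn)
  simp [hvl, hil] at h4
  omega

/-- If every variable but the last lies in the colon ideal at `u`, then all `x_i u / x_n` are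
generators. The proof goes down from `i = n - 1`: if the leading generator of `x_i u` were
`p = x_i u / x_j` with `j < n`, then `x_j ^ 2 p = x_i x_n (x_j u / x_n)` would contradict the
uniqueness of the decomposition of monomials, since `x_n` may always be split off. -/
theorem exists_add_single_lastVar (hn : 1 ≤ n) (hd : Equigenerated I d) (hm : InducedByVars m)
    {u : Fin n →₀ ℕ} (hu : u ∈ minGens I) (hc : colonVars I m u = {lastVar hn}ᶜ) (i : Fin n) :
    ∃ p ∈ minGens I, Finsupp.single (lastVar hn) 1 + p = Finsupp.single i 1 + u := by
  induction i using WellFoundedGT.induction with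
  | _ i ih =>
  by_cases hil : i = lastVar hn
  · exact ⟨u, hu, by rw [hil]⟩
  have hiu : ¬ IsLeadGen I m u (Finsupp.single i 1 + u) := by
    have : i ∈ colonVars I m u := by rw [hc]; exact hil
    exact this
  obtain ⟨p, hp⟩ := exists_isLeadGen m
    (monomial_mem_of_le hu.1 (le_add_self : u ≤ Finsupp.single i 1 + u))
  have hup : m.toSyn u < m.toSyn p := by
    refine lt_of_le_of_ne (hp.2.2 u hu le_add_self) fun h => hiu ?_
    rwa [m.toSyn.injective h] at hp ⊢
  obtain ⟨j, hij, hj⟩ := exists_add_single_eq hd hm hu hp.1 hup hp.2.1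
  by_cases hjl : j = lastVar hn
  · exact ⟨p, hp.1, by rw [← hj, hjl]⟩
  exfalso
  obtain ⟨q, hq, hqu⟩ := ih j hij
  obtain ⟨r, hr⟩ := exists_isLeadGen m
    (monomial_mem_of_le hq.1 (le_add_self : q ≤ Finsupp.single i 1 + q))
  obtain ⟨c, hrc⟩ := exists_add_of_le hr.2.1
  rw [add_comm r] at hrc
  rw [← hj] at hp
  rw [hrc] at hr
  have h1 := hI.isLeadGen_single_add hp (fun h => h hp)
  have h2 := hI.isLeadGen_single_add hr (lastVar_notMem_colonVars hn hd hm hr.1)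
  have h3 : Finsupp.single j 1 + Finsupp.single j 1 + p =
      Finsupp.single (lastVar hn) 1 + c + r := by
    rw [add_assoc, hj, add_assoc, ← hrc, add_left_comm, ← hqu, add_left_comm]
  rw [← h3] at h2
  obtain rfl := h1.unique h2
  have h4 := DFunLike.congr_fun (add_right_cancel h3) (lastVar hn)
  simp [hjl] at h4
  omega

/-- If `I` is saturated, no generator has the largest possible set of colon variables. -/
theorem colonVars_ne (hn : 1 ≤ n) (hd : Equigenerated I d) (hm : InducedByVars m)
    (hsupp : supp I = Set.univ) (hsat : I.colon (irrelevant K n) ≤ I)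
    {u : Fin n →₀ ℕ} (hu : u ∈ minGens I) : colonVars I m u ≠ {lastVar hn}ᶜ := by
  intro hc
  have hd1 := hd.one_le hn hsupp
  choose p hp hpu using hI.exists_add_single_lastVar hn hd hm hu hc
  have hul : u (lastVar hn) ≠ 0 := by
    rcases Nat.lt_or_ge 1 n with h1 | h1
    · have hne : (⟨0, hn⟩ : Fin n) ≠ lastVar hn := by
        intro h
        have := congrArg Fin.val h
        simp only [lastVar] at this
        omega
      have := DFunLike.congr_fun (hpu ⟨0, hn⟩) (lastVar hn)
      simp only [Finsupp.add_apply, Finsupp.single_apply, hne, if_true, if_false] at this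
      omega
    · intro h0
      have : u = 0 := by
        ext i
        have : i = lastVar hn := Fin.ext (by simp only [lastVar]; omega)
        rw [this, h0]; rfl
      have hdu := hd u hu
      rw [this, map_zero] at hdu
      omega
  obtain ⟨w, rfl⟩ := exists_add_of_le
    (Finsupp.single_le_iff.2 (Nat.one_le_iff_ne_zero.2 hul))
  have hw : monomial w (1 : K) ∈ I := by
    refine hsat (monomial_mem_colon_irrelevant.2 fun i => ?_)
    have h1 := hpu i
    rw [add_left_comm] at h1
    rw [add_comm, ← add_left_cancel h1]
    exact (hp i).1
  have h2 := hd.le_degree hw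
  have h3 := hd _ hu
  rw [add_comm, degree_add_single] at h3
  omega

theorem hasProjectiveDimensionLT (hmon : IsMonomialIdeal I) (hd : Equigenerated I d) {k : ℕ}
    (hk : ∀ u ∈ minGens I, (colonVars I m u).ncard ≤ k) :
    HasProjectiveDimensionLT (ModuleCat.of (MvPolynomial (Fin n) K) I) (k + 1) := by
  classical
  have hfin : (minGens I).Finite := by
    refine (Set.finite_Iic (Finsupp.equivFunOnFinite.symm fun _ : Fin n => d)).subset ?_
    intro a ha i
    rw [← hd a ha]
    exact Finsupp.le_degree i a
  -- Adjoin the generators in decreasing order.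
  have key : ∀ U : Finset (Fin n →₀ ℕ), (U : Set (Fin n →₀ ℕ)) ⊆ minGens I →
      (∀ a ∈ U, ∀ b ∈ minGens I, m.toSyn a < m.toSyn b → b ∈ U) →
      HasProjectiveDimensionLT (ModuleCat.of (MvPolynomial (Fin n) K)
        (monomialSpan K (U : Set (Fin n →₀ ℕ)))) (k + 1) := by
    intro U
    induction U using Finset.induction_on_min_value m.toSyn with
    | empty =>
      intro _ _
      have := hasProjectiveDimensionLT_zero_of_eq_bot
        (N := monomialSpan K ((∅ : Finset (Fin n →₀ ℕ)) : Set (Fin n →₀ ℕ)))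
        (by simp [monomialSpan])
      exact hasProjectiveDimensionLT_of_ge _ 0 _ (by omega)
    | insert u U huU hmin ih =>
      intro hU hup
      have hu : u ∈ minGens I := hU (by simp)
      have hUeq : (U : Set (Fin n →₀ ℕ)) = {b | b ∈ minGens I ∧ m.toSyn u < m.toSyn b} := by
        ext b
        refine ⟨fun hb => ⟨hU (by simp [Finset.mem_coe.1 hb]), lt_of_le_of_ne (hmin b hb) ?_⟩,
          fun hb => ?_⟩
        · intro h
          exact huU (m.toSyn.injective h ▸ hb)
        · rcases Finset.mem_insert.1 (hup u (Finset.mem_insert_self _ _) b hb.1 hb.2) with rfl | h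
          · exact absurd hb.2 (lt_irrefl _)
          · exact h
      have ih' := ih (fun b hb => hU (by simp [Finset.mem_coe.1 hb])) fun a ha b hb hab => by
        rcases Finset.mem_insert.1 (hup a (Finset.mem_insert_of_mem ha) b hb hab) with rfl | h
        · exact absurd hab (not_lt.2 (hmin a ha))
        · exact h
      have hins : monomialSpan K ((insert u U : Finset (Fin n →₀ ℕ)) : Set (Fin n →₀ ℕ)) =
          monomialSpan K (U : Set (Fin n →₀ ℕ)) ⊔ Ideal.span {monomial u (1 : K)} := by
        rw [monomialSpan, Finset.coe_insert, Set.image_insert_eq, Ideal.span_insert, sup_comm]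
        rfl
      rw [hins]
      refine hasProjectiveDimensionLT_sup_span ?_ ih'
      rw [hUeq, hI.colon_eq hu]
      have h1 := hasProjectiveDimensionLT_span_X (K := K) (Set.toFinset (colonVars I m u))
      rw [Set.coe_toFinset, ← Set.ncard_eq_toFinset_card'] at h1
      exact hasProjectiveDimensionLT_of_ge _ _ _ (hk u hu)
  have := key hfin.toFinset (by simp) (by simp +contextual)
  rwa [Set.Finite.coe_toFinset, ← hmon.eq_monomialSpan_minGens] at this

theorem pd_eq_iff (hn : 1 ≤ n) (hmon : IsMonomialIdeal I) (hd : Equigenerated I d)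
    (hm : InducedByVars m) (hsupp : supp I = Set.univ) :
    pd I = ((n - 1 : ℕ) : WithBot ℕ∞) ↔ soc I d ≠ ⊥ := by
  have hle : ∀ u ∈ minGens I, colonVars I m u ⊆ {lastVar hn}ᶜ := fun u hu =>
    Set.subset_compl_singleton_iff.2 (lastVar_notMem_colonVars hn hd hm hu)
  have hcard : ({lastVar hn}ᶜ : Set (Fin n)).ncard = n - 1 := by
    rw [Set.ncard_compl, Set.ncard_singleton, Nat.card_fin]
  rw [soc_ne_bot_iff hn hmon hd (hI.socleInDegree hn hd hm)]
  refine pd_eq_iff_not_colon_le hn (ne_bot_of_supp hn hsupp) ?_ fun hsat => ?_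
  · have := hI.hasProjectiveDimensionLT hmon hd (k := n - 1) fun u hu =>
      hcard ▸ Set.ncard_le_ncard (hle u hu)
    rwa [Nat.sub_add_cancel hn] at this
  · have hlt : ∀ u ∈ minGens I, (colonVars I m u).ncard < n - 1 := fun u hu =>
      hcard ▸ Set.ncard_lt_ncard
        ((hle u hu).ssubset_of_ne (hI.colonVars_ne hn hd hm hsupp hsat hu))
    obtain ⟨u, hu⟩ := (minGens_nonempty_iff hmon).2 (ne_bot_of_supp hn hsupp)
    have h0 := hlt u hu
    have := hI.hasProjectiveDimensionLT hmon hd (k := n - 2) fun u hu => by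
      have := hlt u hu
      omega
    rwa [show n - 2 + 1 = n - 1 by omega] at this

end HasLinearQuotients

/-- Multiplying by `x_n` turns the generators of the socle ideal into generators of `I`. -/
theorem minGens_soc_eq (hn : 1 ≤ n) (hd : Equigenerated I d) :
    minGens (soc I d) = {w | ∃ u ∈ minGens I, 1 ≤ u (lastVar hn) ∧
      w = u - Finsupp.single (lastVar hn) 1 ∧ ∀ i : Fin n, w + Finsupp.single i 1 ∈ minGens I} := by
  ext w
  rw [mem_minGens_soc_iff hn hd]
  constructor
  · rintro ⟨hw, hwd⟩
    have h : ∀ i, w + Finsupp.single i 1 ∈ minGens I := fun i =>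
      hd.mem_minGens_iff.2 ⟨hw i, by rw [degree_add_single, hwd]⟩
    exact ⟨_, h (lastVar hn), by simp, by simp, h⟩
  · rintro ⟨-, -, -, -, h⟩
    exact ⟨fun i => (h i).1, by rw [← degree_add_single w ⟨0, hn⟩, hd _ (h _)]⟩

end

end MonIdeal

/-- Exponent vectors stand for monomials: `w + single i 1` is `x_i w`, and for `u` with
`1 ≤ u (lastVar hn)`, i.e. `x_n ∣ u`, the vector `u - single (lastVar hn) 1` is `u / x_n`. -/
theorem theorem3p3 {K : Type u} [Field K] (n : ℕ) (hn : 1 ≤ n) :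
    (∀ (I : Ideal (MvPolynomial (Fin n) K)) (d : ℕ),
      MonIdeal.IsMonomialIdeal I →
      MonIdeal.HasLinearResolution I d →
      MonIdeal.supp I = Set.univ →
        (∀ J, MonIdeal.IsSocleIdeal I d J ↔ J = MonIdeal.soc I d) ∧
        (MonIdeal.pd I = ((n - 1 : ℕ) : WithBot ℕ∞) ↔ MonIdeal.soc I d ≠ ⊥)) ∧
    (∀ (I : Ideal (MvPolynomial (Fin n) K)) (d : ℕ) (m : MonomialOrder (Fin n)),
      MonIdeal.IsMonomialIdeal I →
      MonIdeal.Equigenerated I d →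
      MonIdeal.InducedByVars m →
      MonIdeal.HasLinearQuotients I m →
      MonIdeal.supp I = Set.univ →
        (∀ J, MonIdeal.IsSocleIdeal I d J ↔ J = MonIdeal.soc I d) ∧
        List.TFAE
          [MonIdeal.pd I = ((n - 1 : ℕ) : WithBot ℕ∞),
           MonIdeal.soc I d ≠ ⊥,
           ∃ u ∈ MonIdeal.minGens I, 1 ≤ u (MonIdeal.lastVar hn) ∧
             ∀ i : Fin n,
               u - Finsupp.single (MonIdeal.lastVar hn) 1 + Finsupp.single i 1 ∈
                 MonIdeal.minGens I] ∧
        MonIdeal.minGens (MonIdeal.soc I d) =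
          {w | ∃ u ∈ MonIdeal.minGens I, 1 ≤ u (MonIdeal.lastVar hn) ∧
            w = u - Finsupp.single (MonIdeal.lastVar hn) 1 ∧
            ∀ i : Fin n, w + Finsupp.single i 1 ∈ MonIdeal.minGens I}) := by
  refine ⟨fun I d hI h hsupp => ⟨fun J => ?_, h.pd_eq_iff hn hI hsupp⟩,
    fun I d m hI hd hm hlq hsupp => ⟨fun J => ?_, ?_, MonIdeal.minGens_soc_eq hn hd⟩⟩
  · exact MonIdeal.isSocleIdeal_iff hn hI (h.equigenerated hI) (h.socleInDegree hn hI) J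
  · exact MonIdeal.isSocleIdeal_iff hn hI hd (hlq.socleInDegree hn hd hm) J
  · tfae_have 1 ↔ 2 := hlq.pd_eq_iff hn hI hd hm hsupp
    tfae_have 2 ↔ 3 := by
      rw [← MonIdeal.minGens_nonempty_iff MonIdeal.isMonomialIdeal_soc,
        MonIdeal.minGens_soc_eq hn hd]
      exact ⟨fun ⟨_, u, hu, h1, hw, h⟩ => ⟨u, hu, h1, fun i => hw ▸ h i⟩,
        fun ⟨u, hu, h1, h⟩ => ⟨_, u, hu, h1, rfl, h⟩⟩
    tfae_finish
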